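/- **Setting.** Let $d\ge 1$ and let $\mathbf X$ be a spatial point process on $\mathbb R^d$ (a locally finite random subset of $\mathbb R^d$), observed in windows $D_n=nE=\{ne: e\in E\}$, $n\ge 1$, where $E\subset\mathbb R^d$ is convex, compact and contains the origin in its interior; $|D_n|$ is the Lebesgue measure of $D_n$. Let $z_1,z_2,\dots:\mathbb R^d\to\mathbb R$ be measurable covariates, $(p_n)$ a sequence of dimensions, $\mathbf z(u)=(z_1(u),\dots,z_{p_n}(u))^\top$, $\rho(u;\boldsymbol\beta)=\exp(\mathbf z(u)^\top\boldsymbol\beta)$ for $\boldsymbol\beta\in\mathbb R^{p_n}$, and let $w:\mathbb R^d\to[0,\infty)$ be a measurable weight function. The true parameter is $\boldsymbol\beta_0=(\beta_{01},\dots,\beta_{0s},0,\dots,0)^\top\in\mathbb R^{p_n}$, where $s\le p_n$ and the non-zero coefficients $\beta_{01},\dots,\beta_{0s}$ do not depend on $n$. For a penalty family $(p_\lambda)_{\lambda\ge0}$ and tuning parameters $\lambda_{n,j}\ge 0$ put $$Q_n(w;\boldsymbol\beta)=\sum_{u\in\mathbf X\cap D_n}w(u)\log\rho(u;\boldsymbol\beta)-\int_{D_n}w(u)\rho(u;\boldsymbol\beta)\,\mathrm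 du-|D_n|\sum_{j=1}^{p_n}p_{\lambda_{n,j}}(|\beta_j|),$$ $$a_n=\max_{j\le s}|p'_{\lambda_{n,j}}(|\beta_{0j}|)|,\qquad c_n=\max_{j\le s}|p''_{\lambda_{n,j}}(|\beta_{0j}|)|,\qquad \mathbf A_n=\int_{D_n}w(u)\mathbf z(u)\mathbf z(u)^\top\rho(u;\boldsymbol\beta_0)\,\mathrm du .$$ For $k,l\in\mathbb N\cup\{\infty\}$ the mixing coefficient $\alpha_{k,l}(q)$ is the supremum of $|\mathrm P(A\cap B)-\mathrm P(A)\mathrm P(B)|$ over $A\in\mathscr F(\Lambda_1)$, $B\in\mathscr F(\Lambda_2)$ and Borel sets $\Lambda_1,\Lambda_2$ with $|\Lambda_1|\le k$, $|\Lambda_2|\le l$ and distance at least $q$, where $\mathscr F(\Lambda)$ is the $\sigma$-algebra generated by $\mathbf X\cap\Lambda$. **Conditions.** 1. $\mathbf X$ has intensity function $\rho(\cdot;\boldsymbol\beta_0)$; $\boldsymbol\beta_0\in\Theta_n$ with $\Theta_n\subset\mathbb R^{p_n}$ open, convex and bounded; and there are neighbourhoods $\Xi_n\subset\mathbb R^{p_n}$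 of $\boldsymbol\beta_0$ with $\sup_n\sup_{\boldsymbol\beta\in\Xi_n}\sup_{u}\rho(u;\boldsymbol\beta)<\infty$. 2. $\sup_n\sup_{i\le p_n}\sup_u|z_i(u)|<\infty$ and $\sup_u w(u)<\infty$. 3. There is an integer $t\ge1$ such that for $k=2,\dots,2+t$ the product density $\rho^{(k)}$ of $\mathbf X$ exists and is bounded. 4. $\alpha_{2,\infty}(q)=O(q^{-\tilde t})$ as $q\to\infty$ for some $\tilde t>d(2+t)/t$. 5. $\liminf_n\nu_{\min}(|D_n|^{-1}\mathbf A_n)>0$, where $\nu_{\min}$ is the smallest eigenvalue. 6. For every $\lambda\ge0$, $p_\lambda$ is non-negative on $[0,\infty)$, $p_\lambda(0)=0$, and $p_\lambda$ is continuously differentiable on $(0,\infty)$ with Lipschitz derivative there. Moreover, for $j\le s$ there are $(\tilde r_{n,j})_n$ with $\tilde r_{n,j}\sqrt{|D_n|/p_n}\to\infty$ such that for all large $n$, $p_{\lambda_{n,j}}$ is three times continuously differentiable on the ball with centre $|\beta_{0j}|$ and radius $\tilde r_{n,j}$, with third derivative bounded there uniformly in $n$ and $j$. 7. $p_n^3/|D_n|\to0$.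 **Theorem.** Assume these conditions, $a_n=O(|D_n|^{-1/2})$ and $c_n=o(1)$. Then there are random vectors $\hat{\boldsymbol\beta}=\hat{\boldsymbol\beta}_n\in\mathbb R^{p_n}$ such that, with probability tending to $1$, $\hat{\boldsymbol\beta}$ is a local maximizer of $Q_n(w;\cdot)$, and $$\|\hat{\boldsymbol\beta}-\boldsymbol\beta_0\|=O_{\mathrm P}\big(\sqrt{p_n}\,(|D_n|^{-1/2}+a_n)\big).$$ In particular $\|\hat{\boldsymbol\beta}-\boldsymbol\beta_0\|=O_{\mathrm P}(\sqrt{p_n/|D_n|})$, i.e. $\hat{\boldsymbol\beta}$ is root-$(|D_n|/p_n)$ consistent. If moreover, for every $K>0$, $\Theta_n$ contains the ball with centre $\boldsymbol\beta_0$ and radius $K\sqrt{p_n/|D_n|}$ for all large $n$, then $\hat{\boldsymbol\beta}\in\Theta_n$ with probability tending to $1$. -/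

import Mathlib

open MeasureTheory Filter Topology Set
open scoped ENNReal Pointwise

/-- The observation space `ℝᵈ` with its Euclidean norm and Lebesgue measure. -/
abbrev Space (d : ℕ) : Type := EuclideanSpace ℝ (Fin d)

/-- A (simple) spatial point process on `ℝᵈ`: a locally finite random subset of `ℝᵈ`, random in the
sense that the number of points in every Borel set is a random variable. -/
structure PointProcess (Ω : Type*) [MeasurableSpace Ω] (d : ℕ) where
  /-- the realization of the process -/
  pts : Ω → Set (Space d)
  locallyFinite : ∀ (ω : Ω) (K : Set (Space d)), IsCompact K → (pts ω ∩ K).Finite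
  measurable_count : ∀ B : Set (Space d), MeasurableSet B →
    Measurable fun ω => (pts ω ∩ B).encard

namespace PointProcess

variable {Ω : Type*} [MeasurableSpace Ω] {d : ℕ}

/-- `ρ` is the intensity function of `X` (first-order Campbell formula). -/
def HasIntensity (X : PointProcess Ω d) (μ : Measure Ω) (ρ : Space d → ℝ) : Prop :=
  Measurable ρ ∧ (∀ u, 0 ≤ ρ u) ∧
    ∀ f : Space d → ℝ≥0∞, Measurable f →
      ∫⁻ ω, ∑' u : X.pts ω, f u ∂μ = ∫⁻ u, f u * ENNReal.ofReal (ρ u)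

/-- `ρk` is the product density of order `k` of `X`: the Campbell formula for sums over `k`-tuples
of pairwise distinct points of `X`. -/
def HasProductDensity (X : PointProcess Ω d) (μ : Measure Ω) (k : ℕ)
    (ρk : (Fin k → Space d) → ℝ) : Prop :=
  Measurable ρk ∧ (∀ v, 0 ≤ ρk v) ∧
    ∀ f : (Fin k → Space d) → ℝ≥0∞, Measurable f →
      ∫⁻ ω, ∑' v : {v : Fin k → Space d // Function.Injective v ∧ ∀ i, v i ∈ X.pts ω}, f v ∂μ
        = ∫⁻ v, f v * ENNReal.ofReal (ρk v)

/-- The σ-algebra `𝓕(Λ)` generated by `X ∩ Λ`, that is, by the numbers of points of `X` in the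
Borel subsets of `Λ`. -/
@[reducible] noncomputable def sigmaAlgebra (X : PointProcess Ω d) (Λ : Set (Space d)) : MeasurableSpace Ω :=
  ⨆ (B : Set (Space d)) (_ : MeasurableSet B ∧ B ⊆ Λ),
    MeasurableSpace.comap (fun ω => (X.pts ω ∩ B).encard) inferInstance

/-- The strong mixing coefficient `α_{k,l}(q)`, for `k, l ∈ ℕ ∪ {∞}`. -/
noncomputable def mixingCoeff (X : PointProcess Ω d) (μ : Measure Ω) (k l : ℕ∞) (q : ℝ) : ℝ :=
  sSup {a : ℝ | ∃ Λ₁ Λ₂ : Set (Space d), ∃ A B : Set Ω,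
    MeasurableSet Λ₁ ∧ MeasurableSet Λ₂ ∧
    volume Λ₁ ≤ (k : ℝ≥0∞) ∧ volume Λ₂ ≤ (l : ℝ≥0∞) ∧
    (∀ x ∈ Λ₁, ∀ y ∈ Λ₂, q ≤ dist x y) ∧
    MeasurableSet[X.sigmaAlgebra Λ₁] A ∧ MeasurableSet[X.sigmaAlgebra Λ₂] B ∧
    a = |μ.real (A ∩ B) - μ.real A * μ.real B|}

end PointProcess

/-- The observation window `D_n = nE`. -/
def window {d : ℕ} (E : Set (Space d)) (n : ℕ) : Set (Space d) := (n : ℝ) • E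

/-- The volume `|D_n|`. -/
noncomputable def windowVol {d : ℕ} (E : Set (Space d)) (n : ℕ) : ℝ := volume.real (window E n)

/-- The log-linear intensity `ρ(u; β) = exp(z(u)ᵀ β)` built on the first `p` covariates. -/
noncomputable def intensity {d : ℕ} (z : ℕ → Space d → ℝ) {p : ℕ} (u : Space d)
    (β : EuclideanSpace ℝ (Fin p)) : ℝ :=
  Real.exp (∑ j : Fin p, z j u * β j)

/-- The true parameter `β₀ = (β₀₁ᵀ, 0ᵀ)ᵀ ∈ ℝᵖ`: the `s` coefficients `b` followed by zeros. -/
noncomputable def trueParam {s : ℕ} (b : Fin s → ℝ) (p : ℕ) : EuclideanSpace ℝ (Fin p) :=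
  WithLp.toLp 2 fun j : Fin p => if h : (j : ℕ) < s then b ⟨j, h⟩ else 0

/-- The weighted Poisson likelihood on the window `D` for the point pattern `x`. -/
noncomputable def logLik {d : ℕ} (z : ℕ → Space d → ℝ) (w : Space d → ℝ) (D x : Set (Space d))
    {p : ℕ} (β : EuclideanSpace ℝ (Fin p)) : ℝ :=
  (∑ᶠ u ∈ x ∩ D, w u * Real.log (intensity z u β)) - ∫ u in D, w u * intensity z u β

/-- The penalized weighted Poisson likelihood
`Q(w; β) = ℓ(w; β) - |D| ∑ⱼ p_{λⱼ}(|βⱼ|)`. -/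
noncomputable def penLogLik {d : ℕ} (z : ℕ → Space d → ℝ) (w : Space d → ℝ)
    (pen : ℝ → ℝ → ℝ) (lam : ℕ → ℝ) (D x : Set (Space d))
    {p : ℕ} (β : EuclideanSpace ℝ (Fin p)) : ℝ :=
  logLik z w D x β - volume.real D * ∑ j : Fin p, pen (lam j) |β j|

/-- The matrix `A(w; β) = ∫_D w(u) z(u) z(u)ᵀ ρ(u; β) du`. -/
noncomputable def sensitivity {d : ℕ} (z : ℕ → Space d → ℝ) (w : Space d → ℝ)
    (D : Set (Space d)) {p : ℕ} (β : EuclideanSpace ℝ (Fin p)) : Matrix (Fin p) (Fin p) ℝ :=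
  Matrix.of fun i j => ∫ u in D, w u * (z i u * z j u) * intensity z u β

/-- The smallest (real) eigenvalue of a square matrix; used for symmetric matrices. -/
noncomputable def minEigenvalue {p : ℕ} (M : Matrix (Fin p) (Fin p) ℝ) : ℝ :=
  sInf (spectrum ℝ M)

/-- `p_λ`, `λ ≥ 0`, is a family of penalty functions on `[0, ∞)`: `p_λ` is nonnegative, vanishes at
`0`, and is continuously differentiable on `(0, ∞)` with a Lipschitz derivative there. -/
structure IsPenaltyFamily (pen : ℝ → ℝ → ℝ) : Prop where
  zero : ∀ l, 0 ≤ l → pen l 0 = 0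
  nonneg : ∀ l, 0 ≤ l → ∀ θ, 0 ≤ θ → 0 ≤ pen l θ
  contDiffOn : ∀ l, 0 ≤ l → ContDiffOn ℝ 1 (pen l) (Ioi 0)
  lipschitz_deriv : ∀ l, 0 ≤ l → ∃ L, LipschitzOnWith L (deriv (pen l)) (Ioi 0)

/-- `a_n = max_{j ≤ s} |p'_{λ_{n,j}}(|β₀ⱼ|)|` (zero if `s = 0`). -/
noncomputable def aSeq (pen : ℝ → ℝ → ℝ) (lam : ℕ → ℕ → ℝ) {s : ℕ} (b : Fin s → ℝ) (n : ℕ) : ℝ :=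
  ⨆ j : Fin s, |deriv (pen (lam n j)) (|b j|)|

/-- `c_n = max_{j ≤ s} |p''_{λ_{n,j}}(|β₀ⱼ|)|` (zero if `s = 0`). -/
noncomputable def cSeq (pen : ℝ → ℝ → ℝ) (lam : ℕ → ℕ → ℝ) {s : ℕ} (b : Fin s → ℝ) (n : ℕ) : ℝ :=
  ⨆ j : Fin s, |iteratedDeriv 2 (pen (lam n j)) (|b j|)|

/-- `Y_n = O_P(x_n)`. -/
def IsBigOP {Ω : Type*} [MeasurableSpace Ω] (μ : Measure Ω) (Y : ℕ → Ω → ℝ) (x : ℕ → ℝ) : Prop :=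
  ∀ ε : ℝ, 0 < ε → ∃ K : ℝ, 0 < K ∧
    ∀ᶠ n in atTop, μ {ω | K * |x n| < |Y n ω|} ≤ ENNReal.ofReal ε

/-! Log-linearity turns the criterion into `Q_n(β) = ⟪T, β⟫ - G β` with a random vector `T =
covariateSum` and a deterministic lower semicontinuous `G = penCompensator`. The estimator is a
measurable maximizer of `Q_n` over a closed ball of radius `R n` about `β₀`, and its rate is read
off from `Q_n(βhat) ≥ Q_n(β₀)` alone.

For `δ = βhat - β₀` three terms compete. The centred sum `V = T - E T`, which is the score at `β₀`,
gains at most `‖V‖ ‖δ‖`. Since `exp x ≥ 1 + x + x²/4` on `[-1, 1]`, the integral costs at least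
`(ν/4) |D| ‖δ‖²` as long as `√p ‖δ‖` is small. The penalty gains at most `|D| (s a ‖δ‖ + o(1)
‖δ‖²)`, because coordinates that vanish in `β₀` can only be penalized more. Hence `‖δ‖ ≲ ‖V‖ / |D| +
s a` (`norm_le_of_penLogLik_le`).

Probability enters only through `E ‖V‖² = O(p |D|)`, obtained coordinatewise from
`exists_integral_sq_linStat_sub_le`. The window is cut into unit cells. The product density of order
`2 + t` bounds the moments of cell sums, a truncated Davydov inequality turns mixing at distance `q`
into covariances of order `q ^ (-τ t / (2 + t))`, and `τ > d (2 + t) / t` makes these summable over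
`ℤᵈ`.

So `‖δ‖ = O_P(e n)` with `e n = √(p n / |D_n|)`. Since `p³ / |D|` vanishes and the smoothness radii
are large compared with `e n`, `R n` can be taken much larger than `e n`. The maximizer is then
interior to the ball with high probability, hence a local maximizer. -/

/-! ### Measurable selection of maximizers. -/

section ArgmaxSelection

variable {V : Type*} [NormedAddCommGroup V] [InnerProductSpace ℝ V]

/-- The maximizers over `K` of the tilted function `β ↦ ⟪T, β⟫ - G β`. -/
def tiltedArgmax (G : V → ℝ) (K : Set V) (T : V) : Set V :=
  {β | β ∈ K ∧ ∀ γ ∈ K, inner ℝ T γ - G γ ≤ inner ℝ T β - G β}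

/-- For each fixed competitor `γ` the maximality inequality describes a sublevel set of a function
lower semicontinuous in the pair, so continuity of `G` is not needed. -/
lemma isClosed_setOf_mem_tiltedArgmax {G : V → ℝ} (hG : LowerSemicontinuous G) {K : Set V}
    (hK : IsClosed K) : IsClosed {q : V × V | q.1 ∈ tiltedArgmax G K q.2} := by
  have h : {q : V × V | q.1 ∈ tiltedArgmax G K q.2} =
      {q | q.1 ∈ K} ∩ ⋂ γ ∈ K, {q : V × V | G q.1 + (inner ℝ q.2 γ - inner ℝ q.2 q.1) ≤ G γ} := by
    ext q
    simp only [tiltedArgmax, mem_ofPred_eq, mem_inter_iff, mem_iInter]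
    refine and_congr_right fun _ => forall₂_congr fun γ _ => ?_
    constructor <;> intro h <;> linarith
  rw [h]
  refine (hK.preimage continuous_fst).inter (isClosed_biInter fun γ _ => ?_)
  refine LowerSemicontinuous.isClosed_preimage (f := fun q : V × V =>
    G q.1 + (inner ℝ q.2 γ - inner ℝ q.2 q.1)) ?_ (G γ)
  refine (hG.comp continuous_fst).add (Continuous.lowerSemicontinuous ?_)
  fun_prop

lemma tiltedArgmax_nonempty {G : V → ℝ} (hG : LowerSemicontinuous G) {K : Set V}
    (hK : IsCompact K) (hne : K.Nonempty) (T : V) : (tiltedArgmax G K T).Nonempty := by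
  have hl : LowerSemicontinuous fun β => G β + -(inner ℝ T β : ℝ) :=
    hG.add (Continuous.lowerSemicontinuous (by fun_prop))
  obtain ⟨β, hβ, h⟩ := (hl.lowerSemicontinuousOn K).exists_isMinOn hne hK
  refine ⟨β, hβ, fun γ hγ => ?_⟩
  have := h hγ
  simp only [mem_ofPred_eq] at this
  linarith

/-- A lower semicontinuous function tilted by a linear functional has a measurable selection of
maximizers over a compact set. -/
theorem exists_measurable_tiltedArgmax [MeasurableSpace V] [BorelSpace V]
    {G : V → ℝ} (hG : LowerSemicontinuous G) {K : Set V}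
    (hK : IsCompact K) (hne : K.Nonempty) :
    ∃ φ : V → V, Measurable φ ∧ ∀ T, φ T ∈ tiltedArgmax G K T := by
  have : Nonempty K := hne.to_subtype
  have : CompactSpace K := isCompact_iff_compactSpace.mp hK
  -- A compact metrizable set is a continuous image of the Cantor set, whose linear order gives a
  -- canonical choice: the least code of a maximizer.
  obtain ⟨g, hgc, hgs⟩ := exists_nat_bool_continuous_surjective_of_compact K
  set ψ : cantorSet → V := fun c => g (cantorSetHomeomorphNatToBool c) with hψ
  have hψc : Continuous ψ :=
    continuous_subtype_val.comp (hgc.comp cantorSetHomeomorphNatToBool.continuous)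
  have : CompactSpace cantorSet := isCompact_iff_compactSpace.mp isCompact_cantorSet
  have hcl : IsClosed {q : cantorSet × V | ψ q.1 ∈ tiltedArgmax G K q.2} :=
    (isClosed_setOf_mem_tiltedArgmax hG hK.isClosed).preimage
      (f := fun q : cantorSet × V => (ψ q.1, q.2)) (by fun_prop)
  have hmin : ∀ T, ∃ c : cantorSet, ψ c ∈ tiltedArgmax G K T ∧
      ∀ c', ψ c' ∈ tiltedArgmax G K T → c ≤ c' := by
    intro T
    have hc : IsCompact {c : cantorSet | ψ c ∈ tiltedArgmax G K T} :=
      (hcl.preimage (f := fun c : cantorSet => (c, T)) (by fun_prop)).isCompact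
    have hn : {c : cantorSet | ψ c ∈ tiltedArgmax G K T}.Nonempty := by
      obtain ⟨β, hβ⟩ := tiltedArgmax_nonempty hG hK hne T
      obtain ⟨x, hx⟩ := hgs ⟨β, hβ.1⟩
      exact ⟨cantorSetHomeomorphNatToBool.symm x, by simpa [hψ, hx] using hβ⟩
    obtain ⟨c, hc, hc'⟩ := hc.exists_isLeast hn
    exact ⟨c, hc, fun c' h => hc' h⟩
  choose ξ hξ hξ' using hmin
  refine ⟨fun T => ψ (ξ T), hψc.measurable.comp ?_, hξ⟩
  refine Measurable.subtype_mk (f := fun T => (ξ T : ℝ)) (measurable_of_Iic fun a => ?_)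
  -- Minimality of `ξ T` makes this sublevel set a projection of a closed set along a compact
  -- factor, hence closed.
  have : (fun T => (ξ T : ℝ)) ⁻¹' Iic a =
      Prod.snd '' ({q : cantorSet × V | ψ q.1 ∈ tiltedArgmax G K q.2} ∩ {q | (q.1 : ℝ) ≤ a}) := by
    ext T
    simp only [mem_preimage, mem_Iic, mem_image, mem_inter_iff, mem_ofPred_eq, Prod.exists,
      exists_eq_right]
    exact ⟨fun h => ⟨ξ T, hξ T, h⟩, fun ⟨c, h, h'⟩ => le_trans (hξ' T c h) h'⟩
  rw [this]
  exact (isClosedMap_snd_of_compactSpace _ (hcl.inter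
    (isClosed_le (by fun_prop) continuous_const))).measurableSet

end ArgmaxSelection

/-! ### Covariance inequality under strong mixing. -/

section Covariance

/-- Product of truncations as a double layer-cake integral. -/
lemma min_mul_min_eq_integral {T x y : ℝ} (hT : 0 ≤ T) (hx : 0 ≤ x) (hy : 0 ≤ y) :
    min x T * min y T = ∫ q in Ioc 0 T ×ˢ Ioc 0 T,
      (Ioi q.1 ×ˢ Ioi q.2).indicator (fun _ => (1 : ℝ)) (x, y) := by
  have h1 : ∀ x : ℝ, 0 ≤ x → min x T = ∫ s in Ioc 0 T, (Iio x).indicator (fun _ => (1 : ℝ)) s := by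
    intro x hx
    rw [setIntegral_indicator measurableSet_Iio, setIntegral_const]
    have : volume.real (Ioc 0 T ∩ Iio x) = min x T := by
      rw [measureReal_def, measure_congr ((Ioo_ae_eq_Ioc (μ := volume)).symm.inter (ae_eq_refl (Iio x)))]
      have : Ioo 0 T ∩ Iio x = Ioo 0 (min x T) := by
        ext y; simp; tauto
      rw [this, Real.volume_Ioo, sub_zero, ENNReal.toReal_ofReal (le_min hx hT)]
    simp [this]
  rw [h1 x hx, h1 y hy, ← setIntegral_prod_mul]
  congr 1
  ext q
  simp only [indicator, mem_prod, mem_Ioi, mem_Iio]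
  split_ifs <;> simp_all

lemma integral_min_mul_min_eq {ν : Measure (ℝ × ℝ)} [IsFiniteMeasure ν] {T : ℝ} (hT : 0 ≤ T)
    (hν : ∀ᵐ q ∂ν, 0 ≤ q.1 ∧ 0 ≤ q.2) :
    Integrable (fun q : ℝ × ℝ => ν.real (Ioi q.1 ×ˢ Ioi q.2))
      (volume.restrict (Ioc 0 T ×ˢ Ioc 0 T)) ∧
    ∫ q, min q.1 T * min q.2 T ∂ν
      = ∫ q in Ioc 0 T ×ˢ Ioc 0 T, ν.real (Ioi q.1 ×ˢ Ioi q.2) := by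
  have hfin : IsFiniteMeasure ((volume : Measure (ℝ × ℝ)).restrict (Ioc 0 T ×ˢ Ioc 0 T)) := by
    constructor
    rw [Measure.restrict_apply_univ, Measure.volume_eq_prod, Measure.prod_prod]
    exact ENNReal.mul_lt_top (by simp) (by simp)
  have hm : MeasurableSet ({a : (ℝ × ℝ) × (ℝ × ℝ) | a.2.1 < a.1.1} ∩ {a | a.2.2 < a.1.2}) :=
    (measurableSet_lt (by fun_prop) (by fun_prop)).inter
      (measurableSet_lt (by fun_prop) (by fun_prop))
  have hF : Integrable (fun a : (ℝ × ℝ) × (ℝ × ℝ) =>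
      (Ioi a.2.1 ×ˢ Ioi a.2.2).indicator (fun _ => (1 : ℝ)) a.1)
      (ν.prod (volume.restrict (Ioc 0 T ×ˢ Ioc 0 T))) := by
    have : (fun a : (ℝ × ℝ) × (ℝ × ℝ) =>
      (Ioi a.2.1 ×ˢ Ioi a.2.2).indicator (fun _ => (1 : ℝ)) a.1) =
      ({a : (ℝ × ℝ) × (ℝ × ℝ) | a.2.1 < a.1.1} ∩ {a | a.2.2 < a.1.2}).indicator fun _ => 1 := by
      ext a; simp [indicator]
    rw [this]
    exact (integrable_const _).indicator hm
  have hin : ∀ q : ℝ × ℝ, ∫ a, (Ioi q.1 ×ˢ Ioi q.2).indicator (fun _ => (1 : ℝ)) a ∂ν =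
      ν.real (Ioi q.1 ×ˢ Ioi q.2) := fun q => by
    rw [integral_indicator (measurableSet_Ioi.prod measurableSet_Ioi)]; simp
  constructor
  · have := hF.integral_prod_right
    simpa only [hin] using this
  · rw [integral_congr_ae (g := fun q => ∫ r in Ioc 0 T ×ˢ Ioc 0 T,
      (Ioi r.1 ×ˢ Ioi r.2).indicator (fun _ => (1 : ℝ)) q), integral_integral_swap hF]
    · simp only [hin]
    · filter_upwards [hν] with q hq using min_mul_min_eq_integral hT hq.1 hq.2

/-- By the layer-cake formula the difference is an integral, over a square of area `T ^ 2`, of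
differences of quadrant probabilities. -/
lemma abs_integral_min_mul_min_sub_le {ν₁ ν₂ : Measure (ℝ × ℝ)} [IsFiniteMeasure ν₁]
    [IsFiniteMeasure ν₂] {T α : ℝ} (hT : 0 ≤ T)
    (h₁ : ∀ᵐ q ∂ν₁, 0 ≤ q.1 ∧ 0 ≤ q.2) (h₂ : ∀ᵐ q ∂ν₂, 0 ≤ q.1 ∧ 0 ≤ q.2)
    (h : ∀ s t, |ν₁.real (Ioi s ×ˢ Ioi t) - ν₂.real (Ioi s ×ˢ Ioi t)| ≤ α) :
    |∫ q, min q.1 T * min q.2 T ∂ν₁ - ∫ q, min q.1 T * min q.2 T ∂ν₂| ≤ α * T ^ 2 := by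
  obtain ⟨i₁, e₁⟩ := integral_min_mul_min_eq hT h₁
  obtain ⟨i₂, e₂⟩ := integral_min_mul_min_eq hT h₂
  rw [e₁, e₂, ← integral_sub i₁ i₂]
  have hv : (volume : Measure (ℝ × ℝ)) (Ioc 0 T ×ˢ Ioc 0 T) = ENNReal.ofReal (T ^ 2) := by
    rw [Measure.volume_eq_prod, Measure.prod_prod, Real.volume_Ioc, sub_zero,
      ← ENNReal.ofReal_mul hT, sq]
  have := norm_setIntegral_le_of_norm_le_const (μ := volume) (C := α)
    (f := fun q : ℝ × ℝ => ν₁.real (Ioi q.1 ×ˢ Ioi q.2) - ν₂.real (Ioi q.1 ×ˢ Ioi q.2))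
    (s := Ioc 0 T ×ˢ Ioc 0 T) (by rw [hv]; exact ENNReal.ofReal_lt_top)
    (fun q _ => h q.1 q.2)
  simpa [measureReal_def, hv, ENNReal.toReal_ofReal (sq_nonneg T)] using this

/-- Nothing is lost if both arguments are at most `T`. Otherwise the larger one, `m ≥ T`, satisfies
`x * y ≤ m ^ 2 ≤ m ^ (2 + t) / T ^ t`. -/
lemma mul_sub_min_mul_min_le {x y T : ℝ} (hT : 0 < T) (hx : 0 ≤ x) (hy : 0 ≤ y) (t : ℕ) :
    0 ≤ x * y - min x T * min y T ∧
      x * y - min x T * min y T ≤ (x ^ (2 + t) + y ^ (2 + t)) / T ^ t := by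
  have h0 : min x T * min y T ≤ x * y :=
    mul_le_mul (min_le_left _ _) (min_le_left _ _) (le_min hy hT.le) hx
  refine ⟨by linarith, ?_⟩
  have key : ∀ m : ℝ, T ≤ m → m * m ≤ m ^ (2 + t) / T ^ t := by
    intro m hm
    rw [le_div_iff₀ (by positivity), pow_add, sq]
    exact mul_le_mul_of_nonneg_left (pow_le_pow_left₀ hT.le hm t) (mul_self_nonneg m)
  have hn : 0 ≤ min x T * min y T := by positivity
  rcases le_total x T with h1 | h1 <;> rcases le_total y T with h2 | h2
  · rw [min_eq_left h1, min_eq_left h2, sub_self]; positivity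
  · have := key y h2
    have h3 : x * y ≤ y * y := by gcongr; linarith
    have : x ^ (2 + t) / T ^ t ≥ 0 := by positivity
    rw [add_div]; linarith
  · have := key x h1
    have h3 : x * y ≤ x * x := by gcongr; linarith
    have : y ^ (2 + t) / T ^ t ≥ 0 := by positivity
    rw [add_div]; linarith
  · have h3 := key x h1
    have h4 := key y h2
    rw [add_div]; nlinarith [sq_nonneg (x - y)]

/-- The covariance inequality for a nonnegative joint law `ν₁` and the law `ν₂` compared with it,
with bounded moments of order `2 + t`. -/
lemma abs_integral_mul_sub_le {ν₁ ν₂ : Measure (ℝ × ℝ)} [IsFiniteMeasure ν₁]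
    [IsFiniteMeasure ν₂] {T α C : ℝ} (hT : 0 < T) {t : ℕ}
    (h₁ : ∀ᵐ q ∂ν₁, 0 ≤ q.1 ∧ 0 ≤ q.2) (h₂ : ∀ᵐ q ∂ν₂, 0 ≤ q.1 ∧ 0 ≤ q.2)
    (m₁ : Integrable (fun q => q.1 ^ (2 + t) + q.2 ^ (2 + t)) ν₁)
    (m₂ : Integrable (fun q => q.1 ^ (2 + t) + q.2 ^ (2 + t)) ν₂)
    (b₁ : ∫ q, (q.1 ^ (2 + t) + q.2 ^ (2 + t)) ∂ν₁ ≤ C)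
    (b₂ : ∫ q, (q.1 ^ (2 + t) + q.2 ^ (2 + t)) ∂ν₂ ≤ C)
    (h : ∀ s t, |ν₁.real (Ioi s ×ˢ Ioi t) - ν₂.real (Ioi s ×ˢ Ioi t)| ≤ α) :
    |∫ q, q.1 * q.2 ∂ν₁ - ∫ q, q.1 * q.2 ∂ν₂| ≤ α * T ^ 2 + C / T ^ t := by
  have main : ∀ ν : Measure (ℝ × ℝ), IsFiniteMeasure ν → (∀ᵐ q ∂ν, 0 ≤ q.1 ∧ 0 ≤ q.2) →
      Integrable (fun q => q.1 ^ (2 + t) + q.2 ^ (2 + t)) ν →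
      ∫ q, (q.1 ^ (2 + t) + q.2 ^ (2 + t)) ∂ν ≤ C →
      0 ≤ ∫ q, q.1 * q.2 ∂ν - ∫ q, min q.1 T * min q.2 T ∂ν ∧
      ∫ q, q.1 * q.2 ∂ν - ∫ q, min q.1 T * min q.2 T ∂ν ≤ C / T ^ t := by
    intro ν _ hν mν bν
    have id : Integrable (fun q : ℝ × ℝ => q.1 * q.2 - min q.1 T * min q.2 T) ν := by
      refine (mν.div_const (T ^ t)).mono' (by fun_prop) ?_
      filter_upwards [hν] with q hq
      have := mul_sub_min_mul_min_le hT hq.1 hq.2 t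
      rw [Real.norm_eq_abs, abs_of_nonneg this.1]
      exact this.2
    have im : Integrable (fun q : ℝ × ℝ => min q.1 T * min q.2 T) ν := by
      refine (integrable_const (T * T)).mono' (by fun_prop) ?_
      filter_upwards [hν] with q hq
      have h1 : 0 ≤ min q.1 T := le_min hq.1 hT.le
      have h2 : 0 ≤ min q.2 T := le_min hq.2 hT.le
      rw [Real.norm_eq_abs, abs_of_nonneg (by positivity)]
      exact mul_le_mul (min_le_right _ _) (min_le_right _ _) h2 hT.le
    have ip : Integrable (fun q : ℝ × ℝ => q.1 * q.2) ν := by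
      exact (id.add im).congr (Eventually.of_forall fun q => by simp)
    rw [← integral_sub ip im]
    constructor
    · refine integral_nonneg_of_ae ?_
      filter_upwards [hν] with q hq using (mul_sub_min_mul_min_le hT hq.1 hq.2 t).1
    · calc _ ≤ ∫ q, (q.1 ^ (2 + t) + q.2 ^ (2 + t)) / T ^ t ∂ν := by
            refine integral_mono_ae id (mν.div_const _) ?_
            filter_upwards [hν] with q hq using (mul_sub_min_mul_min_le hT hq.1 hq.2 t).2
        _ ≤ C / T ^ t := by
            rw [integral_div]; gcongr
  have a := main ν₁ inferInstance h₁ m₁ b₁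
  have b := main ν₂ inferInstance h₂ m₂ b₂
  have c := abs_integral_min_mul_min_sub_le hT.le h₁ h₂ h
  rw [abs_le] at c ⊢
  constructor <;> linarith [a.1, a.2, b.1, b.2, c.1, c.2]

/-- **Davydov's covariance inequality**, in truncated form: nonnegative variables with bounded
moments of order `2 + t` whose tail events are `α`-mixing. -/
theorem abs_integral_mul_sub_mul_integral_le {Ω : Type*} [MeasurableSpace Ω] {μ : Measure Ω}
    [IsProbabilityMeasure μ] {X Y : Ω → ℝ} (hX : Measurable X) (hY : Measurable Y)
    (hX0 : ∀ ω, 0 ≤ X ω) (hY0 : ∀ ω, 0 ≤ Y ω) {T α C : ℝ} (hT : 0 < T) {t : ℕ}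
    (iX : Integrable (fun ω => X ω ^ (2 + t)) μ) (iY : Integrable (fun ω => Y ω ^ (2 + t)) μ)
    (bX : ∫ ω, X ω ^ (2 + t) ∂μ ≤ C) (bY : ∫ ω, Y ω ^ (2 + t) ∂μ ≤ C)
    (h : ∀ a b, |μ.real ({ω | a < X ω} ∩ {ω | b < Y ω}) -
      μ.real {ω | a < X ω} * μ.real {ω | b < Y ω}| ≤ α) :
    |∫ ω, X ω * Y ω ∂μ - (∫ ω, X ω ∂μ) * ∫ ω, Y ω ∂μ| ≤ α * T ^ 2 + 2 * C / T ^ t := by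
  have hXY : Measurable fun ω => (X ω, Y ω) := hX.prodMk hY
  have := Measure.isProbabilityMeasure_map (μ := μ) hX.aemeasurable
  have := Measure.isProbabilityMeasure_map (μ := μ) hY.aemeasurable
  have := Measure.isProbabilityMeasure_map (μ := μ) hXY.aemeasurable
  have iX' : Integrable (fun x : ℝ => x ^ (2 + t)) (μ.map X) :=
    (integrable_map_measure (by fun_prop) hX.aemeasurable).2 iX
  have iY' : Integrable (fun x : ℝ => x ^ (2 + t)) (μ.map Y) :=
    (integrable_map_measure (by fun_prop) hY.aemeasurable).2 iY
  have eX : ∫ x, x ^ (2 + t) ∂(μ.map X) = ∫ ω, X ω ^ (2 + t) ∂μ :=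
    integral_map hX.aemeasurable (by fun_prop)
  have eY : ∫ x, x ^ (2 + t) ∂(μ.map Y) = ∫ ω, Y ω ^ (2 + t) ∂μ :=
    integral_map hY.aemeasurable (by fun_prop)
  -- The joint law is compared with the product of its marginals; `2 * C` bounds the sum of the two
  -- moments.
  have key := abs_integral_mul_sub_le (ν₁ := μ.map fun ω => (X ω, Y ω))
    (ν₂ := (μ.map X).prod (μ.map Y)) (C := 2 * C) (α := α) hT (t := t) ?_ ?_ ?_ ?_ ?_ ?_ ?_
  · rw [integral_map hXY.aemeasurable (by fun_prop), integral_prod_mul (fun x : ℝ => x) (fun x => x),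
      integral_map hX.aemeasurable (by fun_prop), integral_map hY.aemeasurable (by fun_prop)] at key
    exact key
  · rw [ae_map_iff hXY.aemeasurable (by measurability)]
    exact Eventually.of_forall fun ω => ⟨hX0 ω, hY0 ω⟩
  · have h1 : ∀ᵐ x ∂(μ.map X), 0 ≤ x := by
      rw [ae_map_iff hX.aemeasurable (by measurability)]; exact Eventually.of_forall hX0
    have h2 : ∀ᵐ x ∂(μ.map Y), 0 ≤ x := by
      rw [ae_map_iff hY.aemeasurable (by measurability)]; exact Eventually.of_forall hY0
    exact (Measure.quasiMeasurePreserving_fst.ae h1).and (Measure.quasiMeasurePreserving_snd.ae h2)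
  · exact (integrable_map_measure (by fun_prop) hXY.aemeasurable).2 (iX.add iY)
  · exact (iX'.comp_fst _).add (iY'.comp_snd _)
  · rw [integral_map hXY.aemeasurable (by fun_prop), integral_add iX iY]; linarith
  · rw [integral_add (iX'.comp_fst _) (iY'.comp_snd _), integral_fun_fst (fun x : ℝ => x ^ (2 + t)),
      integral_fun_snd (fun x : ℝ => x ^ (2 + t)), eX, eY]
    simp; linarith
  · intro a b
    have e : μ.real ({ω | a < X ω} ∩ {ω | b < Y ω}) =
        (μ.map fun ω => (X ω, Y ω)).real (Ioi a ×ˢ Ioi b) := by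
      rw [measureReal_def, measureReal_def,
        Measure.map_apply hXY (measurableSet_Ioi.prod measurableSet_Ioi)]; rfl
    rw [← e, measureReal_prod_prod, map_measureReal_apply hX measurableSet_Ioi,
      map_measureReal_apply hY measurableSet_Ioi]
    exact h a b

end Covariance

/-! ### Summability over the integer lattice. -/

section LatticeSum

/-- Integer vectors embed, with the same sup norm, into the rank `d` lattice spanned by the standard
basis. -/
lemma summable_norm_rpow_int {d : ℕ} {κ : ℝ} (hκ : (d : ℝ) < κ) :
    Summable fun k : Fin d → ℤ => ‖k‖ ^ (-κ) := by
  classical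
  let L : Submodule ℤ (Fin d → ℝ) := Submodule.span ℤ (range (Pi.basisFun ℝ (Fin d)))
  have hr : Module.finrank ℤ L = d := by
    rw [ZLattice.rank ℝ L]; simp
  have hs := ZLattice.summable_norm_rpow L (-κ) (by rw [hr]; linarith)
  have hmem : ∀ k : Fin d → ℤ, (fun i => (k i : ℝ)) ∈ L := by
    intro k
    have : (fun i => (k i : ℝ)) = ∑ i, k i • Pi.basisFun ℝ (Fin d) i := by
      ext j; simp [Pi.single_apply]
    rw [this]
    exact Submodule.sum_mem _ fun i _ => Submodule.smul_mem _ _ (Submodule.subset_span ⟨i, rfl⟩)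
  have hinj : Function.Injective fun k : Fin d → ℤ => (⟨fun i => (k i : ℝ), hmem k⟩ : L) := by
    intro k l h
    ext i
    have := congrFun (congrArg Subtype.val h) i
    simpa using this
  refine (hs.comp_injective hinj).congr fun k => ?_
  simp only [Function.comp]
  congr 1
end LatticeSum

/-! ### Linear statistics: measurability, Campbell formula, moments. -/

namespace PointProcess

variable {Ω : Type*} [MeasurableSpace Ω] {d : ℕ}

/-- The linear statistic `∑_{u ∈ X ∩ B} f u`. -/
noncomputable def linStat (X : PointProcess Ω d) (B : Set (Space d)) (f : Space d → ℝ) (ω : Ω) : ℝ :=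
  ∑ᶠ u ∈ X.pts ω ∩ B, f u

lemma sigmaAlgebra_le (X : PointProcess Ω d) (Λ : Set (Space d)) :
    X.sigmaAlgebra Λ ≤ ‹MeasurableSpace Ω› :=
  iSup₂_le fun B hB => (X.measurable_count B hB.1).comap_le

lemma tsum_indicator_const (s B : Set (Space d)) (c : ℝ≥0∞) :
    ∑' u : s, B.indicator (fun _ => c) (u : Space d) = (s ∩ B).encard * c := by
  rw [← ENNReal.tsum_set_const, tsum_subtype s (B.indicator fun _ => c), indicator_indicator,
    tsum_subtype (s ∩ B) fun _ => c]

/-- Counts generate the σ-algebra; linearity and monotone limits extend measurability to sums.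
Locality in `Λ` is what the mixing coefficient requires. -/
lemma measurable_tsum_indicator (X : PointProcess Ω d) {Λ : Set (Space d)} (hΛ : MeasurableSet Λ)
    {f : Space d → ℝ≥0∞} (hf : Measurable f) :
    Measurable[X.sigmaAlgebra Λ] fun ω => ∑' u : X.pts ω, Λ.indicator f u := by
  refine Measurable.ennreal_induction (motive := fun f => Measurable[X.sigmaAlgebra Λ]
    fun ω => ∑' u : X.pts ω, Λ.indicator f u) (fun c s hs => ?_) (fun f g _ hf hg h1 h2 => ?_)
    (fun f hf hm h => ?_) hf
  · have h1 : Measurable[X.sigmaAlgebra Λ] fun ω => (X.pts ω ∩ (Λ ∩ s)).encard := by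
      refine Measurable.mono ?_ (le_iSup₂_of_le (Λ ∩ s) ⟨hΛ.inter hs, inter_subset_left⟩ le_rfl)
        le_rfl
      exact comap_measurable _
    have h2 : Measurable[X.sigmaAlgebra Λ] fun ω =>
        (((X.pts ω ∩ (Λ ∩ s)).encard : ℕ∞) : ℝ≥0∞) * c :=
      Measurable.comp (g := fun k : ℕ∞ => (k : ℝ≥0∞) * c) (measurable_of_countable _) h1
    convert h2 using 2 with ω
    rw [indicator_indicator, tsum_indicator_const]
  · convert h1.add h2 using 2 with ω
    simp only [Pi.add_apply, indicator_add']
    exact ENNReal.tsum_add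
  · convert Measurable.iSup h using 2 with ω
    have h1 : ∀ u, Λ.indicator (fun x => ⨆ n, f n x) u = ⨆ n, Λ.indicator (f n) u := by
      intro u
      by_cases hu : u ∈ Λ <;> simp [hu]
    simp_rw [h1, ENNReal.tsum_eq_iSup_sum]
    rw [iSup_comm]
    refine iSup_congr fun s => ENNReal.finsetSum_iSup_of_monotone fun u m n hmn => ?_
    exact indicator_le_indicator (hm hmn _)

lemma finite_inter (X : PointProcess Ω d) {B : Set (Space d)} (hB : Bornology.IsBounded B) (ω : Ω) :
    (X.pts ω ∩ B).Finite :=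
  (X.locallyFinite ω _ hB.isCompact_closure).subset (inter_subset_inter_right _ subset_closure)

lemma linStat_eq_sum (X : PointProcess Ω d) {B : Set (Space d)} (hB : Bornology.IsBounded B)
    (f : Space d → ℝ) (ω : Ω) :
    X.linStat B f ω = ∑ u ∈ (X.finite_inter hB ω).toFinset, f u :=
  finsum_mem_eq_finite_toFinset_sum f _

lemma linStat_nonneg (X : PointProcess Ω d) (B : Set (Space d)) {f : Space d → ℝ}
    (hf : ∀ u, 0 ≤ f u) (ω : Ω) : 0 ≤ X.linStat B f ω :=
  finsum_nonneg fun u => finsum_nonneg fun _ => hf u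

lemma ofReal_linStat (X : PointProcess Ω d) {B : Set (Space d)} (hB : Bornology.IsBounded B)
    {f : Space d → ℝ} (hf : ∀ u, 0 ≤ f u) (ω : Ω) :
    ENNReal.ofReal (X.linStat B f ω) =
      ∑' u : X.pts ω, B.indicator (fun u => ENNReal.ofReal (f u)) (u : Space d) := by
  rw [X.linStat_eq_sum hB, ENNReal.ofReal_sum_of_nonneg fun u _ => hf u,
    tsum_subtype (X.pts ω) (B.indicator fun u => ENNReal.ofReal (f u)), indicator_indicator,
    tsum_eq_sum (s := (X.finite_inter hB ω).toFinset)]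
  · refine Finset.sum_congr rfl fun u hu => ?_
    rw [indicator_of_mem (by simpa using hu)]
  · intro u hu
    exact indicator_of_notMem (by simpa using hu) _

lemma linStat_sub (X : PointProcess Ω d) {B : Set (Space d)} (hB : Bornology.IsBounded B)
    (f g : Space d → ℝ) (ω : Ω) :
    X.linStat B (fun u => f u - g u) ω = X.linStat B f ω - X.linStat B g ω := by
  simp only [X.linStat_eq_sum hB, Finset.sum_sub_distrib]

lemma measurable_linStat_sigmaAlgebra (X : PointProcess Ω d) {B : Set (Space d)}
    (hB : Bornology.IsBounded B) (hBm : MeasurableSet B) {f : Space d → ℝ} (hfm : Measurable f)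
    (hf : ∀ u, 0 ≤ f u) : Measurable[X.sigmaAlgebra B] (X.linStat B f) := by
  have h := (X.measurable_tsum_indicator hBm hfm.ennreal_ofReal).ennreal_toReal
  convert h using 2 with ω
  rw [← X.ofReal_linStat hB hf, ENNReal.toReal_ofReal (X.linStat_nonneg B hf ω)]

lemma linStat_eq_sub_max (X : PointProcess Ω d) {B : Set (Space d)} (hB : Bornology.IsBounded B)
    (f : Space d → ℝ) : X.linStat B f =
      fun ω => X.linStat B (fun u => max (f u) 0) ω - X.linStat B (fun u => max (-f u) 0) ω := by
  ext ω
  rw [← X.linStat_sub hB]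
  congr 1
  ext u
  rcases le_total (f u) 0 with h | h
  · rw [max_eq_right h, max_eq_left (by linarith)]; ring
  · rw [max_eq_left h, max_eq_right (by linarith)]; ring

lemma measurable_linStat (X : PointProcess Ω d) {B : Set (Space d)}
    (hB : Bornology.IsBounded B) (hBm : MeasurableSet B) {f : Space d → ℝ} (hfm : Measurable f) :
    Measurable (X.linStat B f) := by
  rw [X.linStat_eq_sub_max hB]
  refine Measurable.sub ?_ ?_
  · exact (X.measurable_linStat_sigmaAlgebra hB hBm (by fun_prop)
      fun u => le_max_right _ _).mono (X.sigmaAlgebra_le B) le_rfl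
  · exact (X.measurable_linStat_sigmaAlgebra hB hBm (by fun_prop)
      fun u => le_max_right _ _).mono (X.sigmaAlgebra_le B) le_rfl

/-- Campbell's formula for linear statistics. -/
lemma integral_linStat (X : PointProcess Ω d) {μ : Measure Ω} {ρ : Space d → ℝ}
    (hρ : X.HasIntensity μ ρ) {B : Set (Space d)}
    (hB : Bornology.IsBounded B) (hBm : MeasurableSet B) {f : Space d → ℝ} (hfm : Measurable f)
    (hf : ∀ u, 0 ≤ f u) : ∫ ω, X.linStat B f ω ∂μ = ∫ u in B, f u * ρ u := by
  rw [integral_eq_lintegral_of_nonneg_ae (Eventually.of_forall (X.linStat_nonneg B hf))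
      (X.measurable_linStat hB hBm hfm).aestronglyMeasurable,
    integral_eq_lintegral_of_nonneg_ae
      (Eventually.of_forall fun u => mul_nonneg (hf u) (hρ.2.1 u))
      (hfm.mul hρ.1).aestronglyMeasurable]
  simp_rw [X.ofReal_linStat hB hf]
  rw [hρ.2.2 _ (hfm.ennreal_ofReal.indicator hBm), ← lintegral_indicator hBm]
  congr 2
  ext u
  by_cases hu : u ∈ B <;> simp [hu, ENNReal.ofReal_mul (hf u)]

lemma linStat_le (X : PointProcess Ω d) {B : Set (Space d)} (hB : Bornology.IsBounded B)
    {f : Space d → ℝ} {K : ℝ} (hK : ∀ u, f u ≤ K) (ω : Ω) :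
    X.linStat B f ω ≤ K * (X.pts ω ∩ B).ncard := by
  rw [X.linStat_eq_sum hB, ncard_eq_toFinset_card _ (X.finite_inter hB ω), mul_comm,
    ← nsmul_eq_mul]
  exact Finset.sum_le_card_nsmul _ _ _ fun u _ => hK u

/-- The tuples counted are the embeddings of `Fin r` into `s ∩ B`. With this, a product density
controls factorial moments of counts. -/
lemma tsum_injective_indicator {s B : Set (Space d)} (hB : (s ∩ B).Finite) (r : ℕ) :
    ∑' v : {v : Fin r → Space d // Function.Injective v ∧ ∀ i, v i ∈ s},
        (univ.pi fun _ : Fin r => B).indicator (fun _ => (1 : ℝ≥0∞)) (v : Fin r → Space d) =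
      ((s ∩ B).ncard.descFactorial r : ℕ) := by
  classical
  have := hB.fintype
  have h1 : {v : Fin r → Space d | Function.Injective v ∧ ∀ i, v i ∈ s} ∩
      (univ.pi fun _ : Fin r => B) = range fun e : Fin r ↪ ↥(s ∩ B) => fun i => (e i : Space d) := by
    ext v
    constructor
    · rintro ⟨⟨h, h'⟩, h''⟩
      refine ⟨⟨fun i => ⟨v i, h' i, h'' i (mem_univ i)⟩, fun i j hij => h ?_⟩, rfl⟩
      exact congrArg Subtype.val hij
    · rintro ⟨e, rfl⟩
      exact ⟨⟨fun i j hij => e.injective (Subtype.ext hij), fun i => (e i).2.1⟩,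
        fun i _ => (e i).2.2⟩
  have h2 := tsum_subtype {v : Fin r → Space d | Function.Injective v ∧ ∀ i, v i ∈ s}
    ((univ.pi fun _ : Fin r => B).indicator fun _ => (1 : ℝ≥0∞))
  refine h2.trans ?_
  rw [indicator_indicator, ← tsum_subtype _ fun _ => (1 : ℝ≥0∞), ENNReal.tsum_set_const, mul_one, h1,
    ← image_univ, InjOn.encard_image, encard_univ, ENat.card_eq_coe_fintype_card,
    Fintype.card_embedding_eq, ncard_eq_toFinset_card', toFinset_card, Fintype.card_fin]
  · simp
  · intro e _ e' _ h
    ext i : 2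
    exact congrFun h i

lemma lintegral_descFactorial_le (X : PointProcess Ω d) {μ : Measure Ω} {r : ℕ}
    {ρr : (Fin r → Space d) → ℝ} (hρ : X.HasProductDensity μ r ρr) {M : ℝ} (hM : ∀ v, ρr v ≤ M)
    {B : Set (Space d)} (hB : Bornology.IsBounded B) (hBm : MeasurableSet B) (hv : volume B ≤ 1) :
    ∫⁻ ω, (((X.pts ω ∩ B).ncard.descFactorial r : ℕ) : ℝ≥0∞) ∂μ ≤ ENNReal.ofReal M := by
  have hpm : MeasurableSet (univ.pi fun _ : Fin r => B) := MeasurableSet.univ_pi fun _ => hBm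
  simp_rw [← tsum_injective_indicator (X.finite_inter hB _) r]
  rw [hρ.2.2 _ (measurable_const.indicator hpm)]
  calc _ ≤ ∫⁻ v, (univ.pi fun _ : Fin r => B).indicator (fun _ => ENNReal.ofReal M) v := by
        refine lintegral_mono fun v => ?_
        by_cases h : v ∈ univ.pi fun _ : Fin r => B
        · simpa [h] using ENNReal.ofReal_le_ofReal (hM v)
        · simp only [indicator_of_notMem h]; simp
    _ = ENNReal.ofReal M * volume B ^ r := by
        rw [lintegral_indicator hpm, setLIntegral_const, volume_pi_pi]; simp
    _ ≤ ENNReal.ofReal M * 1 := by gcongr; exact pow_le_one₀ (by simp) hv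
    _ = _ := mul_one _

/-- For `n ≥ 2 * r` each factor of the falling factorial is at least `n / 2`; smaller `n` go into
the constant. This converts factorial moments into ordinary ones. -/
lemma _root_.Nat.pow_le_add_descFactorial (n r : ℕ) :
    n ^ r ≤ (2 * r) ^ r + 2 ^ r * n.descFactorial r := by
  rcases le_total n (2 * r) with h | h
  · exact (Nat.pow_le_pow_left h r).trans (Nat.le_add_right _ _)
  · calc n ^ r ≤ (2 * (n + 1 - r)) ^ r := Nat.pow_le_pow_left (by omega) r
      _ = 2 ^ r * (n + 1 - r) ^ r := mul_pow _ _ _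
      _ ≤ 2 ^ r * n.descFactorial r := by gcongr; exact Nat.pow_sub_le_descFactorial n r
      _ ≤ _ := Nat.le_add_left _ _

/-- Linear statistics over sets of volume at most one have bounded moments of order `r` when the
product density of order `r` is bounded. -/
lemma exists_linStat_moment_le (X : PointProcess Ω d) (μ : Measure Ω) [IsProbabilityMeasure μ] {r : ℕ}
    {ρr : (Fin r → Space d) → ℝ} (hρ : X.HasProductDensity μ r ρr) {M : ℝ} (hM : ∀ v, ρr v ≤ M)
    {K : ℝ} :
    ∃ C : ℝ, 0 ≤ C ∧ ∀ (B : Set (Space d)) (f : Space d → ℝ), Bornology.IsBounded B →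
      MeasurableSet B → volume B ≤ 1 → Measurable f → (∀ u, 0 ≤ f u) → (∀ u, f u ≤ K) →
      Integrable (fun ω => X.linStat B f ω ^ r) μ ∧ ∫ ω, X.linStat B f ω ^ r ∂μ ≤ C := by
  refine ⟨(ENNReal.ofReal (K ^ r) * ((2 * r : ℕ) ^ r + 2 ^ r * ENNReal.ofReal M)).toReal,
    ENNReal.toReal_nonneg, fun B f hB hBm hv hfm hf hfK => ?_⟩
  have hK : 0 ≤ K := (hf 0).trans (hfK 0)
  have hm : Measurable (X.linStat B f) := X.measurable_linStat hB hBm hfm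
  have hfin : ENNReal.ofReal (K ^ r) * ((2 * r : ℕ) ^ r + 2 ^ r * ENNReal.ofReal M) ≠ ∞ := by
    finiteness
  have hle : ∫⁻ ω, ENNReal.ofReal (X.linStat B f ω ^ r) ∂μ ≤
      ENNReal.ofReal (K ^ r) * ((2 * r : ℕ) ^ r + 2 ^ r * ENNReal.ofReal M) := by
    calc _ ≤ ∫⁻ ω, ENNReal.ofReal (K ^ r) * ((2 * r : ℕ) ^ r +
          2 ^ r * (((X.pts ω ∩ B).ncard.descFactorial r : ℕ) : ℝ≥0∞)) ∂μ := by
          refine lintegral_mono fun ω => ?_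
          have h1 := pow_le_pow_left₀ (X.linStat_nonneg B hf ω) (X.linStat_le hB hfK ω) r
          rw [mul_pow] at h1
          refine (ENNReal.ofReal_le_ofReal h1).trans ?_
          rw [ENNReal.ofReal_mul (by positivity)]
          gcongr
          rw [ENNReal.ofReal_pow (by positivity), ENNReal.ofReal_natCast]
          exact_mod_cast Nat.pow_le_add_descFactorial _ r
      _ ≤ _ := by
          rw [lintegral_const_mul' _ _ (by finiteness), lintegral_add_left measurable_const,
            lintegral_const_mul' _ _ (by finiteness), lintegral_const, measure_univ, mul_one]
          gcongr
          exact X.lintegral_descFactorial_le hρ hM hB hBm hv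
  have hn : ∀ ω, 0 ≤ X.linStat B f ω ^ r := fun ω => pow_nonneg (X.linStat_nonneg B hf ω) r
  refine ⟨⟨(hm.pow_const r).aestronglyMeasurable, ?_⟩, ?_⟩
  · rw [hasFiniteIntegral_iff_ofReal (Eventually.of_forall hn)]
    exact hle.trans_lt hfin.lt_top
  · rw [integral_eq_lintegral_of_nonneg_ae (Eventually.of_forall hn)
      (hm.pow_const r).aestronglyMeasurable]
    exact ENNReal.toReal_mono hfin hle

end PointProcess

/-! ### Unit cells and their distances. -/

/-- The half-open unit cube with lower corner `i ∈ ℤᵈ`. -/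
def unitCell {d : ℕ} (i : Fin d → ℤ) : Set (Space d) := {x | ∀ k, ⌊x k⌋ = i k}

lemma measurableSet_unitCell {d : ℕ} (i : Fin d → ℤ) : MeasurableSet (unitCell i) := by
  have : unitCell i = ⋂ k, (fun x : Space d => ⌊x k⌋) ⁻¹' {i k} := by
    ext x; simp [unitCell]
  rw [this]
  refine MeasurableSet.iInter fun k => ?_
  have h : Measurable fun x : Space d => ⌊x k⌋ := Int.measurable_floor.comp (by fun_prop)
  exact h (measurableSet_singleton _)

lemma volume_unitCell_le_one {d : ℕ} (i : Fin d → ℤ) : volume (unitCell i) ≤ 1 := by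
  have h : unitCell i = (@WithLp.ofLp 2 (Fin d → ℝ)) ⁻¹'
      (univ.pi fun k => Ico (i k : ℝ) (i k + 1)) := by
    ext x
    simp [unitCell, Int.floor_eq_iff]
  rw [h, (PiLp.volume_preserving_ofLp (Fin d)).measure_preimage
    (MeasurableSet.univ_pi fun k => measurableSet_Ico).nullMeasurableSet, volume_pi_pi]
  simp

/-- Taking integer parts changes a coordinate difference by less than one, and each coordinate is
bounded by the Euclidean norm. -/
lemma norm_sub_one_le_dist {d : ℕ} {i j : Fin d → ℤ} {x y : Space d} (hx : x ∈ unitCell i)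
    (hy : y ∈ unitCell j) : ‖i - j‖ - 1 ≤ dist x y := by
  rw [sub_le_iff_le_add, pi_norm_le_iff_of_nonneg (by positivity)]
  intro k
  have h1 : |x k - y k| ≤ dist x y := by
    rw [dist_eq_norm]; exact PiLp.norm_apply_le (x - y) k
  rw [Pi.sub_apply, Int.norm_eq_abs]
  push_cast
  rw [← hx k, ← hy k]
  have h2 := Int.floor_le (x k)
  have h3 := Int.lt_floor_add_one (x k)
  have h4 := Int.floor_le (y k)
  have h5 := Int.lt_floor_add_one (y k)
  rw [abs_le] at h1 ⊢
  constructor <;> linarith [h1.1, h1.2]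

lemma MeasureTheory.abs_measureReal_inter_sub_le_one {Ω : Type*} [MeasurableSpace Ω] (μ : Measure Ω)
    [IsProbabilityMeasure μ] (A B : Set Ω) : |μ.real (A ∩ B) - μ.real A * μ.real B| ≤ 1 := by
  have h1 : μ.real (A ∩ B) ≤ 1 := measureReal_le_one
  have h2 : μ.real A ≤ 1 := measureReal_le_one
  have h3 : μ.real B ≤ 1 := measureReal_le_one
  have h4 : 0 ≤ μ.real (A ∩ B) := measureReal_nonneg
  have h5 : 0 ≤ μ.real A := measureReal_nonneg
  have h6 : 0 ≤ μ.real B := measureReal_nonneg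
  have h7 : μ.real A * μ.real B ≤ 1 := mul_le_one₀ h2 h6 h3
  have h8 : 0 ≤ μ.real A * μ.real B := by positivity
  rw [abs_le]
  constructor <;> linarith

/-! ### Variance of linear statistics under mixing. -/

namespace PointProcess

variable {Ω : Type*} [MeasurableSpace Ω] {d : ℕ}

/-- The supremum is a real `sSup`, so the uniform bound by one is needed for it to be an upper
bound. -/
lemma le_mixingCoeff (X : PointProcess Ω d) (μ : Measure Ω) [IsProbabilityMeasure μ] {k l : ℕ∞}
    {q : ℝ} {Λ₁ Λ₂ : Set (Space d)} {A B : Set Ω} (h₁ : MeasurableSet Λ₁) (h₂ : MeasurableSet Λ₂)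
    (v₁ : volume Λ₁ ≤ (k : ℝ≥0∞)) (v₂ : volume Λ₂ ≤ (l : ℝ≥0∞))
    (hq : ∀ x ∈ Λ₁, ∀ y ∈ Λ₂, q ≤ dist x y)
    (hA : MeasurableSet[X.sigmaAlgebra Λ₁] A) (hB : MeasurableSet[X.sigmaAlgebra Λ₂] B) :
    |μ.real (A ∩ B) - μ.real A * μ.real B| ≤ X.mixingCoeff μ k l q := by
  refine le_csSup ⟨1, ?_⟩ ⟨Λ₁, Λ₂, A, B, h₁, h₂, v₁, v₂, hq, hA, hB, rfl⟩
  rintro _ ⟨_, _, A, B, -, -, -, -, -, -, -, rfl⟩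
  exact abs_measureReal_inter_sub_le_one μ A B

lemma memLp_two_of_integrable_pow {μ : Measure Ω} [IsFiniteMeasure μ] {Y : Ω → ℝ}
    (hY : Measurable Y) (h0 : ∀ ω, 0 ≤ Y ω) {t : ℕ} (h : Integrable (fun ω => Y ω ^ (2 + t)) μ) :
    MemLp Y 2 μ := by
  rw [memLp_two_iff_integrable_sq hY.aestronglyMeasurable]
  refine ((integrable_const (1 : ℝ)).add h).mono' (by fun_prop) (Eventually.of_forall fun ω => ?_)
  have := h0 ω
  rw [Real.norm_eq_abs, abs_of_nonneg (by positivity), Pi.add_apply]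
  rcases le_total (Y ω) 1 with h1 | h1
  · have : Y ω ^ 2 ≤ 1 := pow_le_one₀ this h1
    have : 0 ≤ Y ω ^ (2 + t) := by positivity
    linarith
  · have : Y ω ^ 2 ≤ Y ω ^ (2 + t) := pow_le_pow_right₀ h1 (Nat.le_add_right _ _)
    linarith

/-- With mixing of order `q ^ (-τ)`, truncating at `T = q ^ (τ / (2 + t))` gives both terms of the
covariance bound the same order. -/
lemma rpow_tradeoff {τ q A C : ℝ} (hq : 0 < q) (t : ℕ) :
    A * q ^ (-τ) * (q ^ (τ / (2 + t))) ^ 2 + 2 * C / (q ^ (τ / (2 + t))) ^ t =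
      (A + 2 * C) * q ^ (-(τ * t / (2 + t))) := by
  have h2 : (2 + t : ℝ) ≠ 0 := by positivity
  have e1 : (q ^ (τ / (2 + t))) ^ 2 = q ^ (τ / (2 + t) * 2) := by
    rw [Real.rpow_mul hq.le]; norm_cast
  have e2 : (q ^ (τ / (2 + t))) ^ t = q ^ (τ * t / (2 + t)) := by
    rw [mul_div_right_comm, Real.rpow_mul hq.le]; norm_cast
  have e3 : -τ + τ / (2 + t) * 2 = -(τ * t / (2 + t)) := by
    field_simp
    ring
  rw [e1, e2, mul_assoc, ← Real.rpow_add hq, e3, Real.rpow_neg hq.le, div_eq_mul_inv (2 * C), add_mul]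

/-- Covariances of linear statistics over unit cells are summable, uniformly in the statistic. -/
lemma exists_summable_covariance_le (X : PointProcess Ω d) (μ : Measure Ω) [IsProbabilityMeasure μ]
    {t : ℕ} (ht : 1 ≤ t) {ρr : (Fin (2 + t) → Space d) → ℝ}
    (hρ : X.HasProductDensity μ (2 + t) ρr) {M : ℝ} (hM : ∀ v, ρr v ≤ M)
    (hmix : ∃ τ : ℝ, (d : ℝ) * (2 + t) / t < τ ∧
      (fun q : ℝ => X.mixingCoeff μ 2 ⊤ q) =O[atTop] fun q : ℝ => q ^ (-τ)) (K : ℝ) :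
    ∃ c : (Fin d → ℤ) → ℝ, Summable c ∧ (∀ k, 0 ≤ c k) ∧
      ∀ (D : Set (Space d)) (f : Space d → ℝ), Bornology.IsBounded D → MeasurableSet D →
        Measurable f → (∀ u, 0 ≤ f u) → (∀ u, f u ≤ K) →
        (∀ i, MemLp (X.linStat (D ∩ unitCell i) f) 2 μ) ∧
        ∀ i j, |ProbabilityTheory.covariance (X.linStat (D ∩ unitCell i) f)
          (X.linStat (D ∩ unitCell j) f) μ| ≤ c (i - j) := by
  obtain ⟨τ, hτ, hO⟩ := hmix
  obtain ⟨C, hC0, hC⟩ := X.exists_linStat_moment_le μ hρ hM (K := K)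
  obtain ⟨A, hA0, hA⟩ := hO.exists_pos
  obtain ⟨q₀, hq₀⟩ := eventually_atTop.1 hA.bound
  set q₁ := max q₀ 1 with hq₁
  set κ := τ * t / (2 + t) with hκdef
  have ht' : (0 : ℝ) < t := by exact_mod_cast ht
  have hκ : (d : ℝ) < κ := by
    rw [hκdef, lt_div_iff₀ (by positivity)]
    rwa [div_lt_iff₀ ht'] at hτ
  -- For distant cells `‖k‖ / 2` is at most the distance `‖k‖ - 1`, as `q₁ ≥ 1`. The constant for
  -- near cells is the covariance bound with `T = 1` and `α = 1`.
  refine ⟨fun k => if 2 * q₁ ≤ ‖k‖ then (A + 2 * C) * (‖k‖ / 2) ^ (-κ) else 1 + 2 * C,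
    ?_, ?_, ?_⟩
  · refine Summable.of_norm_bounded_eventually
      (g := fun k : Fin d → ℤ => (A + 2 * C) * (2 ^ κ) * ‖k‖ ^ (-κ))
      ((summable_norm_rpow_int hκ).mul_left _) ?_
    have h := tendsto_norm_cocompact_atTop (E := Fin d → ℤ)
    rw [cocompact_eq_cofinite] at h
    filter_upwards [h.eventually_ge_atTop (2 * q₁)] with k hk
    rw [if_pos hk, Real.norm_eq_abs, abs_of_nonneg (by positivity), Real.div_rpow (by positivity)
      (by positivity), Real.rpow_neg (by norm_num : (0:ℝ) ≤ 2), div_inv_eq_mul]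
    apply le_of_eq; ring
  · intro k
    dsimp only
    split_ifs <;> positivity
  intro D f hD hDm hfm hf0 hfK
  have hb : ∀ i : Fin d → ℤ, Bornology.IsBounded (D ∩ unitCell i) := fun i =>
    hD.subset inter_subset_left
  have hm : ∀ i : Fin d → ℤ, MeasurableSet (D ∩ unitCell i) := fun i =>
    hDm.inter (measurableSet_unitCell i)
  have hv : ∀ i : Fin d → ℤ, volume (D ∩ unitCell i) ≤ 1 := fun i =>
    (measure_mono inter_subset_right).trans (volume_unitCell_le_one i)
  have hS : ∀ i : Fin d → ℤ, Measurable (X.linStat (D ∩ unitCell i) f) := fun i =>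
    X.measurable_linStat (hb i) (hm i) hfm
  have hS0 : ∀ (i : Fin d → ℤ) ω, 0 ≤ X.linStat (D ∩ unitCell i) f ω := fun i =>
    X.linStat_nonneg _ hf0
  have hmom := fun i => hC (D ∩ unitCell i) f (hb i) (hm i) (hv i) hfm hf0 hfK
  have hL : ∀ i : Fin d → ℤ, MemLp (X.linStat (D ∩ unitCell i) f) 2 μ := fun i =>
    memLp_two_of_integrable_pow (hS i) (hS0 i) (hmom i).1
  refine ⟨hL, fun i j => ?_⟩
  rw [ProbabilityTheory.covariance_eq_sub (hL i) (hL j)]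
  have cov := fun {T α : ℝ} (hT : 0 < T) => abs_integral_mul_sub_mul_integral_le (α := α)
    (hS i) (hS j) (hS0 i) (hS0 j) hT (hmom i).1 (hmom j).1 (hmom i).2 (hmom j).2
  dsimp only
  split_ifs with hij
  · set q := ‖i - j‖ / 2 with hq
    have hq1 : q₁ ≤ q := by rw [hq]; linarith
    have hq2 : 1 ≤ q := (le_max_right _ _).trans hq1
    have hα := hq₀ q ((le_max_left _ _).trans hq1)
    rw [← rpow_tradeoff (by positivity)]
    refine cov (Real.rpow_pos_of_pos (by positivity) _) fun a b => ?_
    rw [Real.norm_eq_abs (q ^ (-τ)), abs_of_nonneg (by positivity)] at hα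
    refine le_trans ?_ ((Real.le_norm_self _).trans hα)
    refine X.le_mixingCoeff μ (hm i) (hm j) ?_ (by simp) ?_ ?_ ?_
    · exact (hv i).trans (by norm_num)
    · intro x hx y hy
      have := norm_sub_one_le_dist hx.2 hy.2
      linarith
    · exact X.measurable_linStat_sigmaAlgebra (hb i) (hm i) hfm hf0 measurableSet_Ioi
    · exact X.measurable_linStat_sigmaAlgebra (hb j) (hm j) hfm hf0 measurableSet_Ioi
  · have := cov (α := 1) one_pos fun a b => abs_measureReal_inter_sub_le_one μ _ _
    simpa using this

lemma linStat_eq_sum_unitCell (X : PointProcess Ω d) {D : Set (Space d)}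
    (hD : Bornology.IsBounded D) {I : Finset (Fin d → ℤ)} (hI : ∀ x ∈ D, (fun k => ⌊x k⌋) ∈ I)
    (f : Space d → ℝ) (ω : Ω) :
    X.linStat D f ω = ∑ i ∈ I, X.linStat (D ∩ unitCell i) f ω := by
  classical
  rw [X.linStat_eq_sum hD, ← Finset.sum_fiberwise_of_maps_to (t := I)
    (g := fun x : Space d => fun k => ⌊x k⌋)]
  · refine Finset.sum_congr rfl fun i _ => ?_
    rw [X.linStat_eq_sum (hD.subset inter_subset_left)]
    refine Finset.sum_congr ?_ fun _ _ => rfl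
    ext x
    simp only [Finset.mem_filter, Finite.mem_toFinset, mem_inter_iff, unitCell, mem_ofPred_eq,
      funext_iff, and_assoc]
  · intro x hx
    exact hI x (by simpa using hx : x ∈ X.pts ω ∧ x ∈ D).2

/-- The variance of a linear statistic is at most proportional to the number of unit cells that
are needed to cover the window. -/
lemma exists_variance_linStat_le (X : PointProcess Ω d) (μ : Measure Ω) [IsProbabilityMeasure μ]
    {t : ℕ} (ht : 1 ≤ t) {ρr : (Fin (2 + t) → Space d) → ℝ}
    (hρ : X.HasProductDensity μ (2 + t) ρr) {M : ℝ} (hM : ∀ v, ρr v ≤ M)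
    (hmix : ∃ τ : ℝ, (d : ℝ) * (2 + t) / t < τ ∧
      (fun q : ℝ => X.mixingCoeff μ 2 ⊤ q) =O[atTop] fun q : ℝ => q ^ (-τ)) (K : ℝ) :
    ∃ C : ℝ, 0 ≤ C ∧ ∀ (D : Set (Space d)) (I : Finset (Fin d → ℤ)) (f : Space d → ℝ),
      Bornology.IsBounded D → MeasurableSet D → (∀ x ∈ D, (fun k => ⌊x k⌋) ∈ I) →
      Measurable f → (∀ u, 0 ≤ f u) → (∀ u, f u ≤ K) →
      MemLp (X.linStat D f) 2 μ ∧
        ProbabilityTheory.variance (X.linStat D f) μ ≤ C * I.card := by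
  obtain ⟨c, hc, hc0, h⟩ := X.exists_summable_covariance_le μ ht hρ hM hmix K
  refine ⟨∑' k, c k, tsum_nonneg hc0, fun D I f hD hDm hI hfm hf0 hfK => ?_⟩
  obtain ⟨hL, hcov⟩ := h D f hD hDm hfm hf0 hfK
  have e : X.linStat D f = fun ω => ∑ i ∈ I, X.linStat (D ∩ unitCell i) f ω :=
    funext fun ω => X.linStat_eq_sum_unitCell hD hI f ω
  have hLs : MemLp (X.linStat D f) 2 μ := by
    rw [e]; exact memLp_finsetSum _ fun i _ => hL i
  refine ⟨hLs, ?_⟩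
  rw [← ProbabilityTheory.covariance_self hLs.aestronglyMeasurable.aemeasurable, e,
    ProbabilityTheory.covariance_fun_sum_fun_sum' (fun i _ => hL i) fun i _ => hL i]
  calc _ ≤ ∑ i ∈ I, ∑ j ∈ I, c (i - j) :=
        Finset.sum_le_sum fun i _ => Finset.sum_le_sum fun j _ => (le_abs_self _).trans (hcov i j)
    _ ≤ ∑ i ∈ I, ∑' k, c k := by
        refine Finset.sum_le_sum fun i _ => ?_
        have hs : Summable fun j => c (i - j) := (Equiv.subLeft i).summable_iff.2 hc
        refine (hs.sum_le_tsum I fun j _ => hc0 _).trans_eq ?_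
        exact (Equiv.subLeft i).tsum_eq c
    _ = _ := by rw [Finset.sum_const, nsmul_eq_mul, mul_comm]

end PointProcess

/-! ### Volume and covering of the windows. -/

section Window

variable {d : ℕ} {E : Set (Space d)}

lemma isCompact_window (hE : IsCompact E) (n : ℕ) : IsCompact (window E n) := hE.smul _

lemma windowVol_eq (E : Set (Space d)) (n : ℕ) : windowVol E n = n ^ d * volume.real E := by
  rw [windowVol, window, measureReal_def, Measure.addHaar_smul, ENNReal.toReal_mul,
    ENNReal.toReal_ofReal (abs_nonneg _), measureReal_def, abs_of_nonneg (by positivity)]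
  simp

lemma volume_real_pos (hE : IsCompact E) (h0 : 0 ∈ interior E) : 0 < volume.real E :=
  ENNReal.toReal_pos
    (Measure.measure_pos_of_mem_nhds volume (mem_interior_iff_mem_nhds.1 h0)).ne' hE.measure_ne_top

lemma windowVol_pos (hE : IsCompact E) (h0 : 0 ∈ interior E) {n : ℕ} (hn : 1 ≤ n) :
    0 < windowVol E n := by
  rw [windowVol_eq]
  have := volume_real_pos hE h0
  positivity

/-- The number of unit cells that meet `nE` is at most proportional to `|nE|`. -/
lemma exists_cover_window (hE : IsCompact E) (h0 : 0 ∈ interior E) :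
    ∃ C : ℝ, 0 ≤ C ∧ ∀ n : ℕ, 1 ≤ n → ∃ I : Finset (Fin d → ℤ),
      (∀ x ∈ window E n, (fun k => ⌊x k⌋) ∈ I) ∧ (I.card : ℝ) ≤ C * windowVol E n := by
  classical
  obtain ⟨R', hR'⟩ := hE.isBounded.exists_norm_le
  obtain ⟨R, hR⟩ := exists_nat_ge (max R' 1)
  have hR1 : 1 ≤ R := by exact_mod_cast (le_max_right _ _).trans hR
  have hV := volume_real_pos hE h0
  -- Each side of the box contains `2nR + 1 ≤ 3nR` integers.
  refine ⟨(3 * R) ^ d / volume.real E, by positivity, fun n hn =>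
    ⟨Fintype.piFinset fun _ => Finset.Icc (-(n * R : ℤ)) (n * R), ?_, ?_⟩⟩
  · rintro _ ⟨e, he, rfl⟩
    rw [Fintype.mem_piFinset]
    intro k
    have h1 : |e k| ≤ R :=
      (PiLp.norm_apply_le e k).trans ((hR' e he).trans ((le_max_left _ _).trans hR))
    have h2 : |(n : ℝ) * e k| ≤ n * R := by
      rw [abs_mul, Nat.abs_cast]; gcongr
    rw [abs_le] at h2
    rw [Finset.mem_Icc, Int.le_floor]
    constructor
    · push_cast; exact h2.1
    · have : (⌊((fun x => (n : ℝ) • x) e : Space d) k⌋ : ℝ) ≤ n * R := (Int.floor_le _).trans h2.2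
      exact_mod_cast this
  · rw [Fintype.card_piFinset_const, windowVol_eq, Int.card_Icc]
    have : ((n * R + 1 - -(n * R) : ℤ).toNat : ℝ) ≤ 3 * R * n := by
      have h : ((n * R + 1 - -(n * R) : ℤ).toNat) ≤ 3 * R * n := by
        have : 1 ≤ n * R := Nat.one_le_iff_ne_zero.2 (by positivity)
        have e : 3 * R * n = 3 * (n * R) := by ring
        rw [e]
        zify at this
        have h3 : (0:ℤ) ≤ n * R + 1 - -(n * R) := by linarith
        zify [Int.toNat_of_nonneg h3]
        linarith
      exact_mod_cast h
    push_cast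
    calc _ ≤ (3 * R * n : ℝ) ^ d := by gcongr
      _ = _ := by rw [mul_pow]; field_simp

end Window

/-! ### Mean square bound for centred linear statistics. -/

namespace PointProcess

variable {Ω : Type*} [MeasurableSpace Ω] {d : ℕ}

/-- The centred linear statistics of bounded functions over the windows `nE` have variance
`O(|nE|)`, uniformly in the function. -/
lemma exists_integral_sq_linStat_sub_le (X : PointProcess Ω d) (μ : Measure Ω)
    [IsProbabilityMeasure μ] {E : Set (Space d)} (hE : IsCompact E) (h0 : 0 ∈ interior E)
    {t : ℕ} (ht : 1 ≤ t) {ρr : (Fin (2 + t) → Space d) → ℝ}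
    (hρ : X.HasProductDensity μ (2 + t) ρr) {M : ℝ} (hM : ∀ v, ρr v ≤ M)
    (hmix : ∃ τ : ℝ, (d : ℝ) * (2 + t) / t < τ ∧
      (fun q : ℝ => X.mixingCoeff μ 2 ⊤ q) =O[atTop] fun q : ℝ => q ^ (-τ)) (K : ℝ) :
    ∃ C : ℝ, 0 ≤ C ∧ ∀ (n : ℕ) (f ρ : Space d → ℝ), 1 ≤ n → Measurable f → (∀ u, |f u| ≤ K) →
      X.HasIntensity μ ρ → (∃ R, ∀ u, ρ u ≤ R) →
      Integrable (fun ω => (X.linStat (window E n) f ω - ∫ u in window E n, f u * ρ u) ^ 2) μ ∧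
      ∫ ω, (X.linStat (window E n) f ω - ∫ u in window E n, f u * ρ u) ^ 2 ∂μ
        ≤ C * windowVol E n := by
  obtain ⟨C₁, hC₁, hcov⟩ := exists_cover_window hE h0
  obtain ⟨C₂, hC₂, hvar⟩ := X.exists_variance_linStat_le μ ht hρ hM hmix K
  -- The positive and negative parts of `f` are treated separately and combined by `(x - y)² ≤ 2 (x²
  -- + y²)`. The bound on `ρ` serves integrability only and does not enter the constant.
  refine ⟨2 * (C₂ * C₁ + C₂ * C₁), by positivity, fun n f ρ hn hfm hfK hint ⟨R, hR⟩ => ?_⟩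
  obtain ⟨I, hI, hIc⟩ := hcov n hn
  set D := window E n with hDdef
  have hDc : IsCompact D := isCompact_window hE n
  have hDb := hDc.isBounded
  have hDm := hDc.measurableSet
  have main : ∀ g : Space d → ℝ, Measurable g → (∀ u, 0 ≤ g u) → (∀ u, g u ≤ K) →
      Integrable (fun ω => (X.linStat D g ω - ∫ u in D, g u * ρ u) ^ 2) μ ∧
      ∫ ω, (X.linStat D g ω - ∫ u in D, g u * ρ u) ^ 2 ∂μ ≤ C₂ * C₁ * windowVol E n := by
    intro g hgm hg0 hgK
    obtain ⟨hL, hV⟩ := hvar D I g hDb hDm hI hgm hg0 hgK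
    rw [← X.integral_linStat hint hDb hDm hgm hg0]
    refine ⟨(hL.sub (memLp_const _)).integrable_sq, ?_⟩
    rw [← ProbabilityTheory.variance_eq_integral hL.aestronglyMeasurable.aemeasurable]
    calc _ ≤ C₂ * I.card := hV
      _ ≤ C₂ * (C₁ * windowVol E n) := by gcongr
      _ = _ := by ring
  have hip : ∀ g : Space d → ℝ, Measurable g → (∀ u, 0 ≤ g u) → (∀ u, g u ≤ K) →
      IntegrableOn (fun u => g u * ρ u) D := by
    intro g hgm hg0 hgK
    refine Measure.integrableOn_of_bounded (M := K * R) hDc.measure_ne_top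
      (hgm.mul hint.1).aestronglyMeasurable (Eventually.of_forall fun u => ?_)
    rw [Real.norm_eq_abs, abs_of_nonneg (mul_nonneg (hg0 u) (hint.2.1 u))]
    exact mul_le_mul (hgK u) (hR u) (hint.2.1 u) ((hg0 u).trans (hgK u))
  have hK : 0 ≤ K := (abs_nonneg _).trans (hfK 0)
  have a1 : ∀ u, max (f u) 0 ≤ K := fun u => max_le ((le_abs_self _).trans (hfK u)) hK
  have a2 : ∀ u, max (-f u) 0 ≤ K := fun u => max_le ((neg_le_abs _).trans (hfK u)) hK
  have a3 : ∀ u, 0 ≤ max (f u) 0 := fun u => le_max_right _ _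
  have a4 : ∀ u, 0 ≤ max (-f u) 0 := fun u => le_max_right _ _
  obtain ⟨i₁, b₁⟩ := main (fun u => max (f u) 0) (by fun_prop) a3 a1
  obtain ⟨i₂, b₂⟩ := main (fun u => max (-f u) 0) (by fun_prop) a4 a2
  have em : ∫ u in D, f u * ρ u =
      (∫ u in D, max (f u) 0 * ρ u) - ∫ u in D, max (-f u) 0 * ρ u := by
    rw [← integral_sub (hip _ (by fun_prop) a3 a1) (hip _ (by fun_prop) a4 a2)]
    congr 1
    ext u
    rcases le_total (f u) 0 with h | h
    · rw [max_eq_right h, max_eq_left (by linarith)]; ring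
    · rw [max_eq_left h, max_eq_right (by linarith)]; ring
  have hle : ∀ ω, (X.linStat D f ω - ∫ u in D, f u * ρ u) ^ 2 ≤
      2 * ((X.linStat D (fun u => max (f u) 0) ω - ∫ u in D, max (f u) 0 * ρ u) ^ 2 +
        (X.linStat D (fun u => max (-f u) 0) ω - ∫ u in D, max (-f u) 0 * ρ u) ^ 2) := by
    intro ω
    rw [em, X.linStat_eq_sub_max hDb f]
    dsimp only
    set a := X.linStat D (fun u => max (f u) 0) ω
    set b := X.linStat D (fun u => max (-f u) 0) ω
    set a' := ∫ u in D, max (f u) 0 * ρ u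
    set b' := ∫ u in D, max (-f u) 0 * ρ u
    nlinarith [sq_nonneg ((a - a') + (b - b'))]
  have hi : Integrable (fun ω => (X.linStat D f ω - ∫ u in D, f u * ρ u) ^ 2) μ := by
    refine ((i₁.add i₂).const_mul 2).mono'
      (((X.measurable_linStat hDb hDm hfm).sub_const _).pow_const 2).aestronglyMeasurable
      (Eventually.of_forall fun ω => ?_)
    rw [Real.norm_eq_abs, abs_of_nonneg (sq_nonneg _)]
    exact hle ω
  refine ⟨hi, ?_⟩
  calc _ ≤ _ := integral_mono hi ((i₁.add i₂).const_mul 2) hle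
    _ = 2 * (_ + _) := by rw [integral_const_mul, integral_add' i₁ i₂]
    _ ≤ 2 * (C₂ * C₁ * windowVol E n + C₂ * C₁ * windowVol E n) := by gcongr
    _ = _ := by ring

end PointProcess

/-! ### Exponential, Taylor and eigenvalue inequalities. -/

section Analysis

/-- The third-order remainder is at most `(2/9) |x|³ ≤ (2/9) x²`, and `1/2 - 2/9 > 1/4`. -/
lemma Real.one_add_add_sq_div_four_le_exp {x : ℝ} (hx : |x| ≤ 1) :
    1 + x + x ^ 2 / 4 ≤ Real.exp x := by
  have h := Real.exp_bound hx (n := 3) (by norm_num)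
  norm_num [Finset.sum_range_succ, Nat.factorial] at h
  have h1 : |x| ^ 3 ≤ x ^ 2 := by
    rw [pow_succ, sq_abs]
    exact mul_le_of_le_one_right (sq_nonneg x) hx
  have h2 := (abs_le.1 h).1
  nlinarith [sq_nonneg x]

lemma iteratedDeriv_differentiableAt_of_contDiffOn {f : ℝ → ℝ} {U : Set ℝ} (hU : IsOpen U)
    {n m : ℕ} (hf : ContDiffOn ℝ n f U) (hm : m < n) {x : ℝ} (hx : x ∈ U) :
    DifferentiableAt ℝ (iteratedDeriv m f) x := by
  have h := (hf.differentiableOn_iteratedDerivWithin (m := m) (by exact_mod_cast hm)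
    hU.uniqueDiffOn).differentiableAt (hU.mem_nhds hx)
  refine h.congr_of_eventuallyEq ?_
  filter_upwards [hU.mem_nhds hx] with y hy
  exact (iteratedDerivWithin_of_isOpen hU hy).symm

/-- A second-order Taylor bound with a bound on the third derivative. -/
lemma abs_sub_le_of_iteratedDeriv_three_le {f : ℝ → ℝ} {x r M a c h : ℝ}
    (hf : ContDiffOn ℝ 3 f (Metric.ball x r))
    (hM : ∀ y ∈ Metric.ball x r, |iteratedDeriv 3 f y| ≤ M)
    (ha : |deriv f x| ≤ a) (hc : |iteratedDeriv 2 f x| ≤ c) (hh : |h| < r) :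
    |f (x + h) - f x| ≤ a * |h| + (c + M * |h|) * h ^ 2 := by
  have hr : 0 < r := (abs_nonneg h).trans_lt hh
  have hM0 : 0 ≤ M := (abs_nonneg _).trans (hM x (Metric.mem_ball_self hr))
  have hsub : Metric.closedBall x |h| ⊆ Metric.ball x r := Metric.closedBall_subset_ball hh
  have hx : x ∈ Metric.closedBall x |h| := Metric.mem_closedBall_self (abs_nonneg h)
  have hd : ∀ m : ℕ, m < 3 → ∀ y ∈ Metric.closedBall x |h|,
      DifferentiableAt ℝ (iteratedDeriv m f) y := fun m hm y hy =>
    iteratedDeriv_differentiableAt_of_contDiffOn Metric.isOpen_ball hf hm (hsub hy)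
  -- The mean value inequality is applied in turn to the second derivative, the first derivative and
  -- the function.
  have step : ∀ (m : ℕ) (B : ℝ), m < 3 →
      (∀ y ∈ Metric.closedBall x |h|, |iteratedDeriv (m + 1) f y| ≤ B) → 0 ≤ B →
      ∀ y ∈ Metric.closedBall x |h|, |iteratedDeriv m f y - iteratedDeriv m f x| ≤ B * |h| := by
    intro m B hm hB hB0 y hy
    have := (convex_closedBall x |h|).norm_image_sub_le_of_norm_deriv_le (hd m hm)
      (C := B) (fun z hz => by rw [← iteratedDeriv_succ]; exact hB z hz) hx hy
    refine this.trans (mul_le_mul_of_nonneg_left ?_ hB0)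
    simpa [Real.dist_eq] using hy
  have hc0 : 0 ≤ c := (abs_nonneg _).trans hc
  have ha0 : 0 ≤ a := (abs_nonneg _).trans ha
  have s2 : ∀ y ∈ Metric.closedBall x |h|, |iteratedDeriv 2 f y| ≤ c + M * |h| := by
    intro y hy
    have := step 2 M (by norm_num) (fun y hy => hM y (hsub hy)) hM0 y hy
    linarith [abs_sub_abs_le_abs_sub (iteratedDeriv 2 f y) (iteratedDeriv 2 f x)]
  have s1 : ∀ y ∈ Metric.closedBall x |h|,
      |iteratedDeriv 1 f y| ≤ a + (c + M * |h|) * |h| := by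
    intro y hy
    have := step 1 _ (by norm_num) s2 (by positivity) y hy
    rw [iteratedDeriv_one] at *
    linarith [abs_sub_abs_le_abs_sub (deriv f y) (deriv f x)]
  have := step 0 _ (by norm_num) s1 (by positivity) (x + h) (by simp)
  rw [iteratedDeriv_zero] at this
  refine this.trans_eq ?_
  rw [← sq_abs h]
  ring

/-- Subtracting the least eigenvalue times the identity shifts the spectrum into `[0, ∞)`. -/
lemma minEigenvalue_mul_norm_sq_le {p : ℕ} {A : Matrix (Fin p) (Fin p) ℝ} (hA : A.IsHermitian)
    (x : EuclideanSpace ℝ (Fin p)) :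
    minEigenvalue A * ‖x‖ ^ 2 ≤ ∑ i, ∑ j, x i * x j * A i j := by
  set c := minEigenvalue A with hc
  have hbdd : BddBelow (spectrum ℝ A) := by
    rw [hA.spectrum_real_eq_range_eigenvalues]
    exact (finite_range _).bddBelow
  have hps : (A - algebraMap ℝ (Matrix (Fin p) (Fin p) ℝ) c).PosSemidef := by
    rw [Matrix.posSemidef_iff_isHermitian_and_spectrum_nonneg]
    constructor
    · refine hA.sub ?_
      rw [Matrix.algebraMap_eq_diagonal]
      exact Matrix.isHermitian_diagonal _
    · intro y hy
      rw [← spectrum.sub_singleton_eq] at hy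
      obtain ⟨e, he, _, rfl, rfl⟩ := hy
      have := csInf_le hbdd he
      simp only [mem_ofPred_eq, hc, minEigenvalue]
      linarith
  have h := (Matrix.posSemidef_iff_dotProduct_mulVec.1 hps).2 x
  rw [Matrix.sub_mulVec, dotProduct_sub, Matrix.algebraMap_eq_diagonal] at h
  have e1 : star (x : Fin p → ℝ) ⬝ᵥ A.mulVec x = ∑ i, ∑ j, x i * x j * A i j := by
    simp only [dotProduct, Matrix.mulVec, Finset.mul_sum, star_trivial]
    refine Finset.sum_congr rfl fun i _ => Finset.sum_congr rfl fun j _ => by ring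
  have e2 : star (x : Fin p → ℝ) ⬝ᵥ
      (Matrix.diagonal (algebraMap ℝ (Fin p → ℝ) c)).mulVec x = c * ‖x‖ ^ 2 := by
    rw [EuclideanSpace.real_norm_sq_eq, Finset.mul_sum]
    simp only [dotProduct, Matrix.mulVec_diagonal, star_trivial]
    refine Finset.sum_congr rfl fun i _ => ?_
    simp
    ring
  rw [e1, e2] at h
  linarith

end Analysis

/-! ### Semicontinuity of penalties. -/

section Penalty

/-- The penalty may jump at the origin, but only upwards, since it vanishes there and is
nonnegative. -/
lemma IsPenaltyFamily.lowerSemicontinuous_abs {pen : ℝ → ℝ → ℝ} (hpen : IsPenaltyFamily pen)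
    {l : ℝ} (hl : 0 ≤ l) : LowerSemicontinuous fun x => pen l |x| := by
  intro x
  rcases eq_or_ne x 0 with rfl | hx
  · intro y hy
    simp only [abs_zero, hpen.zero l hl] at hy
    exact Eventually.of_forall fun x' => hy.trans_le (hpen.nonneg l hl _ (abs_nonneg _))
  · refine ContinuousAt.lowerSemicontinuousAt ?_
    have h := (hpen.contDiffOn l hl).continuousOn.continuousAt (Ioi_mem_nhds (abs_pos.2 hx))
    exact ContinuousAt.comp' (g := pen l) h continuous_abs.continuousAt

end Penalty

/-! ### The likelihood as a linear tilt, and its curvature. -/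

section Likelihood

variable {d : ℕ} {z : ℕ → Space d → ℝ} {w : Space d → ℝ} {D : Set (Space d)} {p : ℕ} {M W : ℝ}

lemma abs_sum_mul_le (hM : ∀ j < p, ∀ u, |z j u| ≤ M) (β : EuclideanSpace ℝ (Fin p))
    (u : Space d) : |∑ j : Fin p, z j u * β j| ≤ |M| * √p * ‖β‖ := by
  have h : (∑ j : Fin p, z j u * β j) ^ 2 ≤ (|M| * √p * ‖β‖) ^ 2 := by
    refine (Finset.sum_mul_sq_le_sq_mul_sq _ _ _).trans ?_
    rw [mul_pow, mul_pow, EuclideanSpace.real_norm_sq_eq, Real.sq_sqrt (by positivity)]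
    gcongr
    calc ∑ j : Fin p, z j u ^ 2 ≤ ∑ j : Fin p, |M| ^ 2 := by
          refine Finset.sum_le_sum fun j _ => ?_
          rw [← sq_abs (z j u)]
          exact pow_le_pow_left₀ (abs_nonneg _) ((hM j j.2 u).trans (le_abs_self M)) 2
      _ = _ := by simp [mul_comm]
  exact abs_le_of_sq_le_sq h (by positivity)

lemma intensity_le (hM : ∀ j < p, ∀ u, |z j u| ≤ M) (β : EuclideanSpace ℝ (Fin p)) (u : Space d) :
    intensity z u β ≤ Real.exp (|M| * √p * ‖β‖) :=
  Real.exp_le_exp.2 ((le_abs_self _).trans (abs_sum_mul_le hM β u))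

lemma measurable_intensity (hz : ∀ j, Measurable (z j)) (β : EuclideanSpace ℝ (Fin p)) :
    Measurable fun u => intensity z u β := by
  unfold intensity
  have := hz
  fun_prop

lemma integrableOn_mul_intensity (hz : ∀ j, Measurable (z j)) (hM : ∀ j < p, ∀ u, |z j u| ≤ M)
    (hD : IsCompact D) (β : EuclideanSpace ℝ (Fin p)) {g : Space d → ℝ} (hg : Measurable g)
    {B : ℝ} (hB : ∀ u, |g u| ≤ B) : IntegrableOn (fun u => g u * intensity z u β) D := by
  refine Measure.integrableOn_of_bounded (M := B * Real.exp (|M| * √p * ‖β‖)) hD.measure_ne_top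
    (hg.mul (measurable_intensity hz β)).aestronglyMeasurable (Eventually.of_forall fun u => ?_)
  have h : 0 < intensity z u β := Real.exp_pos _
  rw [norm_mul, Real.norm_eq_abs, Real.norm_eq_abs, abs_of_pos h]
  exact mul_le_mul (hB u) (intensity_le hM β u) h.le ((abs_nonneg _).trans (hB u))

lemma continuous_integral_mul_intensity (hz : ∀ j, Measurable (z j))
    (hM : ∀ j < p, ∀ u, |z j u| ≤ M) (hw : Measurable w) (hw0 : ∀ u, 0 ≤ w u) (hW : ∀ u, w u ≤ W)
    (hD : IsCompact D) :
    Continuous fun β : EuclideanSpace ℝ (Fin p) => ∫ u in D, w u * intensity z u β := by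
  rw [continuous_iff_continuousAt]
  intro β
  have hfin : IsFiniteMeasure (volume.restrict D) :=
    ⟨by rw [Measure.restrict_apply_univ]; exact hD.measure_lt_top⟩
  refine continuousAt_of_dominated (bound := fun _ => W * Real.exp (|M| * √p * (‖β‖ + 1))) ?_ ?_
    (integrable_const _) ?_
  · exact Eventually.of_forall fun β' => (hw.mul (measurable_intensity hz β')).aestronglyMeasurable
  · filter_upwards [Metric.ball_mem_nhds β one_pos] with β' hβ'
    refine Eventually.of_forall fun u => ?_
    have h : 0 < intensity z u β' := Real.exp_pos _
    rw [Real.norm_eq_abs, abs_of_nonneg (mul_nonneg (hw0 u) h.le)]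
    refine mul_le_mul (hW u) ((intensity_le hM β' u).trans ?_) h.le ((hw0 u).trans (hW u))
    rw [mem_ball_iff_norm] at hβ'
    have := norm_sub_norm_le β' β
    gcongr
    linarith
  · refine Eventually.of_forall fun u => ?_
    unfold intensity
    fun_prop

/-- The deterministic part of minus the penalized likelihood. -/
noncomputable def penCompensator (z : ℕ → Space d → ℝ) (w : Space d → ℝ) (pen : ℝ → ℝ → ℝ)
    (lam : ℕ → ℝ) (D : Set (Space d)) (β : EuclideanSpace ℝ (Fin p)) : ℝ :=
  (∫ u in D, w u * intensity z u β) + volume.real D * ∑ j : Fin p, pen (lam j) |β j|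

lemma lowerSemicontinuous_penCompensator (hz : ∀ j, Measurable (z j))
    (hM : ∀ j < p, ∀ u, |z j u| ≤ M) (hw : Measurable w) (hw0 : ∀ u, 0 ≤ w u) (hW : ∀ u, w u ≤ W)
    (hD : IsCompact D) {pen : ℝ → ℝ → ℝ} (hpen : IsPenaltyFamily pen) {lam : ℕ → ℝ}
    (hlam : ∀ j, 0 ≤ lam j) :
    LowerSemicontinuous (penCompensator (p := p) z w pen lam D) := by
  refine (continuous_integral_mul_intensity hz hM hw hw0 hW hD).lowerSemicontinuous.add ?_
  refine Continuous.comp_lowerSemicontinuous (g := fun x => volume.real D * x) (by fun_prop) ?_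
    fun x y h => mul_le_mul_of_nonneg_left h measureReal_nonneg
  refine lowerSemicontinuous_sum fun j _ => ?_
  exact LowerSemicontinuous.comp (f := fun x => pen (lam j) |x|)
    (hpen.lowerSemicontinuous_abs (hlam j))
    (g := fun β : EuclideanSpace ℝ (Fin p) => β j) (by fun_prop)

variable {Ω : Type*} [MeasurableSpace Ω]

/-- The vector of weighted sums `∑_{u ∈ X ∩ D} w(u) z(u)` of the covariates. -/
noncomputable def covariateSum (X : PointProcess Ω d) (z : ℕ → Space d → ℝ) (w : Space d → ℝ)
    (D : Set (Space d)) (p : ℕ) (ω : Ω) : EuclideanSpace ℝ (Fin p) :=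
  WithLp.toLp 2 fun j : Fin p => X.linStat D (fun u => w u * z j u) ω

/-- The expectation `∫_D w(u) z(u) ρ(u; β) du` of `covariateSum` at the parameter `β`. -/
noncomputable def covariateMean (z : ℕ → Space d → ℝ) (w : Space d → ℝ)
    (D : Set (Space d)) (β : EuclideanSpace ℝ (Fin p)) : EuclideanSpace ℝ (Fin p) :=
  WithLp.toLp 2 fun j : Fin p => ∫ u in D, w u * z j u * intensity z u β

lemma measurable_covariateSum (X : PointProcess Ω d) (hz : ∀ j, Measurable (z j))
    (hw : Measurable w) (hD : IsCompact D) (p : ℕ) :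
    Measurable (covariateSum X z w D p) := by
  refine (WithLp.measurable_toLp 2 _).comp (measurable_pi_lambda _ fun j => ?_)
  exact X.measurable_linStat hD.isBounded hD.measurableSet (hw.mul (hz j))

/-- The logarithm of the intensity is linear in `β`, so the data enter only through one random
vector, paired linearly with `β`. -/
lemma penLogLik_eq (X : PointProcess Ω d) (hD : IsCompact D) (pen : ℝ → ℝ → ℝ) (lam : ℕ → ℝ)
    (ω : Ω) (β : EuclideanSpace ℝ (Fin p)) :
    penLogLik z w pen lam D (X.pts ω) β =
      inner ℝ (covariateSum X z w D p ω) β - penCompensator z w pen lam D β := by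
  have hfin := X.finite_inter hD.isBounded ω
  have h : ∑ᶠ u ∈ X.pts ω ∩ D, w u * Real.log (intensity z u β) =
      inner ℝ (covariateSum X z w D p ω) β := by
    rw [finsum_mem_eq_finite_toFinset_sum _ hfin, PiLp.inner_apply]
    simp only [covariateSum, X.linStat_eq_sum hD.isBounded, intensity, Real.log_exp, Finset.mul_sum,
      RCLike.inner_apply, conj_trivial]
    rw [Finset.sum_comm]
    exact Finset.sum_congr rfl fun j _ => Finset.sum_congr rfl fun u _ => by ring
  rw [penLogLik, logLik, penCompensator, h]
  ring

lemma intensity_add (β δ : EuclideanSpace ℝ (Fin p)) (u : Space d) :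
    intensity z u (β + δ) = intensity z u β * Real.exp (∑ j : Fin p, z j u * δ j) := by
  simp only [intensity, ← Real.exp_add, ← Finset.sum_add_distrib, PiLp.add_apply, mul_add]

/-- A quadratic lower bound for the compensator of the weighted likelihood near `β`. -/
lemma integral_mul_intensity_add_ge (hz : ∀ j, Measurable (z j))
    (hM : ∀ j < p, ∀ u, |z j u| ≤ M) (hw : Measurable w) (hw0 : ∀ u, 0 ≤ w u) (hW : ∀ u, w u ≤ W)
    (hD : IsCompact D) (β δ : EuclideanSpace ℝ (Fin p)) (hδ : |M| * √p * ‖δ‖ ≤ 1) :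
    (∫ u in D, w u * intensity z u β) + inner ℝ (covariateMean z w D β) δ +
      (∑ i, ∑ j, δ i * δ j * sensitivity z w D β i j) / 4 ≤
      ∫ u in D, w u * intensity z u (β + δ) := by
  have hwb : ∀ u, |w u| ≤ W := fun u => by rw [abs_of_nonneg (hw0 u)]; exact hW u
  have hW0 : 0 ≤ W := (hw0 0).trans (hW 0)
  have i0 := integrableOn_mul_intensity hz hM hD β hw hwb
  have i0' := integrableOn_mul_intensity hz hM hD (β + δ) hw hwb
  have i1 : ∀ j : Fin p, IntegrableOn (fun u => w u * z j u * intensity z u β) D := fun j =>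
    integrableOn_mul_intensity hz hM hD β (hw.mul (hz j)) (B := W * M) fun u => by
      rw [abs_mul]
      exact mul_le_mul (hwb u) (hM j j.2 u) (abs_nonneg _) hW0
  have i2 : ∀ i j : Fin p, IntegrableOn (fun u => w u * (z i u * z j u) * intensity z u β) D :=
    fun i j => integrableOn_mul_intensity hz hM hD β (hw.mul ((hz i).mul (hz j)))
      (B := W * (M * M)) fun u => by
      rw [abs_mul, abs_mul]
      have hM0 : 0 ≤ M := (abs_nonneg _).trans (hM i i.2 u)
      exact mul_le_mul (hwb u) (mul_le_mul (hM i i.2 u) (hM j j.2 u) (abs_nonneg _) hM0)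
        (by positivity) hW0
  have e1 : inner ℝ (covariateMean z w D β) δ =
      ∫ u in D, ∑ j : Fin p, δ j * (w u * z j u * intensity z u β) := by
    rw [integral_finsetSum _ fun j _ => (i1 j).const_mul _, PiLp.inner_apply]
    refine Finset.sum_congr rfl fun j _ => ?_
    rw [integral_const_mul]
    simp [covariateMean]
  have e2 : ∑ i, ∑ j, δ i * δ j * sensitivity z w D β i j =
      ∫ u in D, ∑ i : Fin p, ∑ j : Fin p,
        δ i * δ j * (w u * (z i u * z j u) * intensity z u β) := by
    rw [integral_finsetSum _ fun i _ => integrable_finsetSum _ fun j _ => (i2 i j).const_mul _]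
    refine Finset.sum_congr rfl fun i _ => ?_
    rw [integral_finsetSum _ fun j _ => (i2 i j).const_mul _]
    refine Finset.sum_congr rfl fun j _ => ?_
    rw [integral_const_mul]
    rfl
  have j1 : IntegrableOn (fun u => ∑ j : Fin p, δ j * (w u * z j u * intensity z u β)) D :=
    integrable_finsetSum _ fun j _ => (i1 j).const_mul _
  have j2 : IntegrableOn (fun u => ∑ i : Fin p, ∑ j : Fin p,
        δ i * δ j * (w u * (z i u * z j u) * intensity z u β)) D :=
    integrable_finsetSum _ fun i _ => integrable_finsetSum _ fun j _ => (i2 i j).const_mul _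
  have j01 : IntegrableOn (fun u => w u * intensity z u β +
      ∑ j : Fin p, δ j * (w u * z j u * intensity z u β)) D := i0.add j1
  rw [e1, e2, ← integral_div, ← integral_add i0 j1, ← integral_add j01 (j2.div_const 4)]
  refine integral_mono (j01.add (j2.div_const 4)) i0' fun u => ?_
  dsimp only
  set x := ∑ j : Fin p, z j u * δ j with hx
  have hx1 : |x| ≤ 1 := (abs_sum_mul_le hM δ u).trans hδ
  have f1 : ∑ j : Fin p, δ j * (w u * z j u * intensity z u β) = w u * intensity z u β * x := by
    rw [hx, Finset.mul_sum]
    exact Finset.sum_congr rfl fun j _ => by ring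
  have f2 : ∑ i : Fin p, ∑ j : Fin p, δ i * δ j * (w u * (z i u * z j u) * intensity z u β) =
      w u * intensity z u β * x ^ 2 := by
    rw [sq, hx, Finset.sum_mul_sum, Finset.mul_sum]
    refine Finset.sum_congr rfl fun i _ => ?_
    rw [Finset.mul_sum]
    exact Finset.sum_congr rfl fun j _ => by ring
  rw [f1, f2, intensity_add, ← hx]
  have h0 : 0 ≤ w u * intensity z u β := mul_nonneg (hw0 u) (Real.exp_pos _).le
  have := mul_le_mul_of_nonneg_left (Real.one_add_add_sq_div_four_le_exp hx1) h0
  linarith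

lemma isHermitian_sensitivity (z : ℕ → Space d → ℝ) (w : Space d → ℝ) (D : Set (Space d))
    (β : EuclideanSpace ℝ (Fin p)) : (sensitivity z w D β).IsHermitian := by
  ext i j
  simp only [sensitivity, Matrix.conjTranspose_apply, Matrix.of_apply, star_trivial, mul_comm]

lemma sensitivity_quadratic_ge {v ν : ℝ} (hv : 0 < v) (β δ : EuclideanSpace ℝ (Fin p))
    (hν : ν ≤ minEigenvalue (v⁻¹ • sensitivity z w D β)) :
    ν * v * ‖δ‖ ^ 2 ≤ ∑ i, ∑ j, δ i * δ j * sensitivity z w D β i j := by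
  have hH : (v⁻¹ • sensitivity z w D β).IsHermitian :=
    (isHermitian_sensitivity z w D β).smul (IsSelfAdjoint.all _)
  have h := minEigenvalue_mul_norm_sq_le hH δ
  have e : ∑ i, ∑ j, δ i * δ j * (v⁻¹ • sensitivity z w D β) i j =
      v⁻¹ * ∑ i, ∑ j, δ i * δ j * sensitivity z w D β i j := by
    simp only [Finset.mul_sum, Matrix.smul_apply, smul_eq_mul]
    exact Finset.sum_congr rfl fun i _ => Finset.sum_congr rfl fun j _ => by ring
  rw [e] at h
  have h1 : ν * ‖δ‖ ^ 2 ≤ v⁻¹ * ∑ i, ∑ j, δ i * δ j * sensitivity z w D β i j :=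
    (mul_le_mul_of_nonneg_right hν (sq_nonneg _)).trans h
  rw [← div_eq_inv_mul, le_div_iff₀ hv] at h1
  linarith

end Likelihood

/-! ### Cost of the penalty near the true parameter. -/

section PenaltyDifference

variable {pen : ℝ → ℝ → ℝ} {lam : ℕ → ℝ} {s : ℕ}

lemma aSeq_nonneg (pen : ℝ → ℝ → ℝ) (lam : ℕ → ℕ → ℝ) (b : Fin s → ℝ) (n : ℕ) :
    0 ≤ aSeq pen lam b n := Real.iSup_nonneg fun _ => abs_nonneg _

lemma cSeq_nonneg (pen : ℝ → ℝ → ℝ) (lam : ℕ → ℕ → ℝ) (b : Fin s → ℝ) (n : ℕ) :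
    0 ≤ cSeq pen lam b n := Real.iSup_nonneg fun _ => abs_nonneg _

lemma sum_ite_lt_le (p s : ℕ) {C : ℝ} (hC : 0 ≤ C) :
    ∑ j : Fin p, (if (j : ℕ) < s then C else 0) ≤ s * C := by
  rw [Fin.sum_univ_eq_sum_range fun j => if j < s then C else 0, ← Finset.sum_filter,
    Finset.sum_const, nsmul_eq_mul]
  gcongr
  calc _ ≤ (Finset.range s).card := Finset.card_le_card fun j hj => by
        simpa using (Finset.mem_filter.1 hj).2
    _ = s := Finset.card_range s

/-- The penalty at the true parameter exceeds that at a nearby parameter by little: only the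
nonzero coefficients contribute. -/
lemma sum_pen_sub_le (hpen : IsPenaltyFamily pen) (hlam : ∀ j, 0 ≤ lam j) (b : Fin s → ℝ) {p : ℕ}
    {a c M : ℝ} {r : Fin s → ℝ} (ha0 : 0 ≤ a) (hc0 : 0 ≤ c) (hM0 : 0 ≤ M)
    (ha : ∀ j : Fin s, |deriv (pen (lam j)) (|b j|)| ≤ a)
    (hc : ∀ j : Fin s, |iteratedDeriv 2 (pen (lam j)) (|b j|)| ≤ c)
    (hsm : ∀ j : Fin s, ContDiffOn ℝ 3 (pen (lam j)) (Metric.ball |b j| (r j)))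
    (hM : ∀ j : Fin s, ∀ θ ∈ Metric.ball |b j| (r j), |iteratedDeriv 3 (pen (lam j)) θ| ≤ M)
    {δ : EuclideanSpace ℝ (Fin p)} (hδ : ∀ j, ‖δ‖ < r j) :
    ∑ j : Fin p, pen (lam j) |trueParam b p j| - ∑ j : Fin p, pen (lam j) |(trueParam b p + δ) j| ≤
      s * (a * ‖δ‖) + (c + M * ‖δ‖) * ‖δ‖ ^ 2 := by
  have hδj : ∀ j, |δ j| ≤ ‖δ‖ := fun j => PiLp.norm_apply_le δ j
  -- Keeping `δ j ^ 2` in the second-order term makes the sum `‖δ‖ ^ 2`, without a factor `s`.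
  have key : ∀ j : Fin p, pen (lam j) |trueParam b p j| - pen (lam j) |(trueParam b p + δ) j| ≤
      (if (j : ℕ) < s then a * ‖δ‖ else 0) + (c + M * ‖δ‖) * δ j ^ 2 := by
    intro j
    rw [PiLp.add_apply]
    by_cases hj : (j : ℕ) < s
    · have hb : trueParam b p j = b ⟨j, hj⟩ := by simp [trueParam, hj]
      rw [if_pos hj, hb]
      set k : Fin s := ⟨j, hj⟩
      set h := |b k + δ j| - |b k| with hh
      have h1 : |h| ≤ |δ j| := by
        have := abs_abs_sub_abs_le (b k + δ j) (b k)
        rwa [add_sub_cancel_left] at this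
      have h2 : |h| ≤ ‖δ‖ := h1.trans (hδj j)
      have h3 := abs_sub_le_of_iteratedDeriv_three_le (hsm k) (hM k) (ha k) (hc k)
        (h2.trans_lt (hδ k))
      have e : |b k| + h = |b k + δ j| := by rw [hh]; ring
      rw [e, abs_sub_comm] at h3
      refine (le_abs_self _).trans (h3.trans ?_)
      have h4 : h ^ 2 ≤ δ j ^ 2 := sq_le_sq.2 h1
      gcongr
    · have hb : trueParam b p j = 0 := by simp [trueParam, hj]
      rw [if_neg hj, hb, abs_zero, hpen.zero _ (hlam _)]
      have h1 := hpen.nonneg _ (hlam j) _ (abs_nonneg (0 + δ j))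
      have h2 : 0 ≤ (c + M * ‖δ‖) * δ j ^ 2 := by positivity
      linarith
  rw [← Finset.sum_sub_distrib]
  refine (Finset.sum_le_sum fun j _ => key j).trans ?_
  rw [Finset.sum_add_distrib, ← Finset.mul_sum, ← EuclideanSpace.real_norm_sq_eq]
  gcongr
  exact sum_ite_lt_le p s (by positivity)

end PenaltyDifference

/-! ### Deterministic localization, score bound, measurable estimator. -/

section Consistency

variable {Ω : Type*} [MeasurableSpace Ω] {d : ℕ}

/-- A parameter near the true one whose penalized likelihood is not smaller lies within a distance
controlled by the score. -/
lemma norm_le_of_penLogLik_le (X : PointProcess Ω d) {z : ℕ → Space d → ℝ} {w : Space d → ℝ}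
    {D : Set (Space d)} {p s : ℕ} {M W : ℝ} (hz : ∀ j, Measurable (z j))
    (hM : ∀ j < p, ∀ u, |z j u| ≤ M) (hw : Measurable w) (hw0 : ∀ u, 0 ≤ w u) (hW : ∀ u, w u ≤ W)
    (hD : IsCompact D) (hv : 0 < volume.real D) {pen : ℝ → ℝ → ℝ} {lam : ℕ → ℝ}
    (hpen : IsPenaltyFamily pen) (hlam : ∀ j, 0 ≤ lam j) (b : Fin s → ℝ)
    {a c M' ν : ℝ} {r : Fin s → ℝ} (ha0 : 0 ≤ a) (hc0 : 0 ≤ c) (hM0 : 0 ≤ M')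
    (ha : ∀ j : Fin s, |deriv (pen (lam j)) (|b j|)| ≤ a)
    (hc : ∀ j : Fin s, |iteratedDeriv 2 (pen (lam j)) (|b j|)| ≤ c)
    (hsm : ∀ j : Fin s, ContDiffOn ℝ 3 (pen (lam j)) (Metric.ball |b j| (r j)))
    (hM' : ∀ j : Fin s, ∀ θ ∈ Metric.ball |b j| (r j), |iteratedDeriv 3 (pen (lam j)) θ| ≤ M')
    (hν : ν ≤ minEigenvalue ((volume.real D)⁻¹ • sensitivity z w D (trueParam b p)))
    {δ : EuclideanSpace ℝ (Fin p)} (hδr : ∀ j, ‖δ‖ < r j) (hδ1 : |M| * √p * ‖δ‖ ≤ 1)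
    (hδc : c + M' * ‖δ‖ ≤ ν / 8) {ω : Ω}
    (hQ : penLogLik z w pen lam D (X.pts ω) (trueParam b p) ≤
      penLogLik z w pen lam D (X.pts ω) (trueParam b p + δ)) :
    ν / 8 * volume.real D * ‖δ‖ ≤
      ‖covariateSum X z w D p ω - covariateMean z w D (trueParam b p)‖ +
        volume.real D * (s * a) := by
  set v := volume.real D
  set β₀ := trueParam b p
  set V := covariateSum X z w D p ω - covariateMean z w D β₀ with hV
  rcases (norm_nonneg δ).eq_or_lt with h0 | h0
  · rw [← h0, mul_zero]; positivity
  have h1 := integral_mul_intensity_add_ge hz hM hw hw0 hW hD β₀ δ hδ1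
  have h2 := sensitivity_quadratic_ge hv β₀ δ hν
  have h3 := mul_le_mul_of_nonneg_left
    (sum_pen_sub_le hpen hlam b ha0 hc0 hM0 ha hc hsm hM' hδr) hv.le
  -- The likelihood supplies curvature `ν / 4`; the penalty takes back at most `ν / 8`.
  have h4 : v * ((c + M' * ‖δ‖) * ‖δ‖ ^ 2) ≤ v * (ν / 8 * ‖δ‖ ^ 2) := by gcongr
  rw [penLogLik_eq X hD, penLogLik_eq X hD, inner_add_right, penCompensator, penCompensator] at hQ
  have h5 : inner ℝ (covariateSum X z w D p ω) δ - inner ℝ (covariateMean z w D β₀) δ ≤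
      ‖V‖ * ‖δ‖ := by
    rw [← inner_sub_left]; exact real_inner_le_norm _ _
  have h6 : ν / 8 * v * ‖δ‖ * ‖δ‖ ≤ (‖V‖ + v * (s * a)) * ‖δ‖ := by
    rw [mul_sub] at h3
    nlinarith
  exact le_of_mul_le_mul_right h6 h0

/-- Chebyshev's inequality for the score vector. -/
lemma exists_measure_lt_norm_score_le (X : PointProcess Ω d) (μ : Measure Ω)
    [IsProbabilityMeasure μ] {E : Set (Space d)} (hE : IsCompact E) (h0 : 0 ∈ interior E)
    {z : ℕ → Space d → ℝ} {w : Space d → ℝ} {M W : ℝ} (hz : ∀ j, Measurable (z j))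
    (hw : Measurable w) (hw0 : ∀ u, 0 ≤ w u) (hW : ∀ u, w u ≤ W)
    {t : ℕ} (ht : 1 ≤ t) {ρr : (Fin (2 + t) → Space d) → ℝ}
    (hρ : X.HasProductDensity μ (2 + t) ρr) {M' : ℝ} (hM' : ∀ v, ρr v ≤ M')
    (hmix : ∃ τ : ℝ, (d : ℝ) * (2 + t) / t < τ ∧
      (fun q : ℝ => X.mixingCoeff μ 2 ⊤ q) =O[atTop] fun q : ℝ => q ^ (-τ)) :
    ∃ C : ℝ, 0 ≤ C ∧ ∀ (n p : ℕ) (β₀ : EuclideanSpace ℝ (Fin p)), 1 ≤ n → 1 ≤ p →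
      (∀ j < p, ∀ u, |z j u| ≤ M) → X.HasIntensity μ (fun u => intensity z u β₀) →
      ∀ L : ℝ, 0 < L →
      μ {ω | L * √(p * windowVol E n) <
        ‖covariateSum X z w (window E n) p ω - covariateMean z w (window E n) β₀‖} ≤
        ENNReal.ofReal (C / L ^ 2) := by
  obtain ⟨C, hC0, hC⟩ := X.exists_integral_sq_linStat_sub_le μ hE h0 ht hρ hM' hmix (W * M)
  refine ⟨C, hC0, fun n p β₀ hn hp hM hint L hL => ?_⟩
  set v := windowVol E n with hv
  have hvpos : 0 < v := windowVol_pos hE h0 hn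
  set V := fun ω => covariateSum X z w (window E n) p ω - covariateMean z w (window E n) β₀
  have hwb : ∀ u, |w u| ≤ W := fun u => by rw [abs_of_nonneg (hw0 u)]; exact hW u
  have hW0 : 0 ≤ W := (hw0 0).trans (hW 0)
  have hj : ∀ j : Fin p, Integrable (fun ω => V ω j ^ 2) μ ∧ ∫ ω, V ω j ^ 2 ∂μ ≤ C * v := fun j =>
    hC n (fun u => w u * z j u) (fun u => intensity z u β₀) hn (hw.mul (hz j))
      (fun u => by
        rw [abs_mul]
        exact mul_le_mul (hwb u) (hM j j.2 u) (abs_nonneg _) hW0) hint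
      -- This bound may grow with `p`; the constant `C` does not depend on it.
      ⟨_, fun u => intensity_le hM β₀ u⟩
  have hi : Integrable (fun ω => ‖V ω‖ ^ 2) μ := by
    simp_rw [EuclideanSpace.real_norm_sq_eq]
    exact integrable_finsetSum _ fun j _ => (hj j).1
  have hb : ∫ ω, ‖V ω‖ ^ 2 ∂μ ≤ p * (C * v) := by
    simp_rw [EuclideanSpace.real_norm_sq_eq]
    rw [integral_finsetSum _ fun j _ => (hj j).1]
    refine (Finset.sum_le_sum fun j _ => (hj j).2).trans ?_
    simp
  have hp' : (0 : ℝ) < p := by exact_mod_cast hp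
  have hm := mul_meas_ge_le_integral_of_nonneg (μ := μ)
    (Eventually.of_forall fun ω => sq_nonneg ‖V ω‖) hi ((L * √(p * v)) ^ 2)
  rw [mul_pow, Real.sq_sqrt (by positivity)] at hm
  have hm' : μ.real {ω | L ^ 2 * (p * v) ≤ ‖V ω‖ ^ 2} ≤ C / L ^ 2 := by
    rw [le_div_iff₀ (by positivity)]
    have hpv : 0 < p * v := by positivity
    refine le_of_mul_le_mul_right ?_ hpv
    linarith
  rw [← ENNReal.ofReal_toReal (measure_ne_top μ _)]
  refine ENNReal.ofReal_le_ofReal (le_trans ?_ hm')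
  refine measureReal_mono fun ω hω => ?_
  have hω' : L * √(p * v) < ‖V ω‖ := hω
  have := pow_le_pow_left₀ (by positivity) hω'.le 2
  rwa [mul_pow, Real.sq_sqrt (by positivity)] at this

/-- Penalized likelihoods have measurable maximizers over closed balls. -/
lemma exists_measurable_isMaxOn_penLogLik (X : PointProcess Ω d) {z : ℕ → Space d → ℝ}
    {w : Space d → ℝ} {D : Set (Space d)} {p : ℕ} {M W : ℝ} (hz : ∀ j, Measurable (z j))
    (hM : ∀ j < p, ∀ u, |z j u| ≤ M) (hw : Measurable w) (hw0 : ∀ u, 0 ≤ w u) (hW : ∀ u, w u ≤ W)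
    (hD : IsCompact D) {pen : ℝ → ℝ → ℝ} {lam : ℕ → ℝ}
    (hpen : IsPenaltyFamily pen) (hlam : ∀ j, 0 ≤ lam j) (β₀ : EuclideanSpace ℝ (Fin p)) (R : ℝ) :
    ∃ βhat : Ω → EuclideanSpace ℝ (Fin p), Measurable βhat ∧ (0 ≤ R → ∀ ω,
      βhat ω ∈ Metric.closedBall β₀ R ∧
      IsMaxOn (penLogLik z w pen lam D (X.pts ω)) (Metric.closedBall β₀ R) (βhat ω)) := by
  by_cases hR : 0 ≤ R
  · obtain ⟨φ, hφ, hmax⟩ := exists_measurable_tiltedArgmax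
      (lowerSemicontinuous_penCompensator hz hM hw hw0 hW hD hpen hlam)
      (isCompact_closedBall β₀ R) (Metric.nonempty_closedBall.2 hR)
    refine ⟨fun ω => φ (covariateSum X z w D p ω),
      hφ.comp (measurable_covariateSum X hz hw hD p), fun _ ω => ⟨(hmax _).1, fun γ hγ => ?_⟩⟩
    simp only [mem_ofPred_eq, penLogLik_eq X hD]
    exact (hmax _).2 γ hγ
  -- For negative `R` the ball is empty, and a constant keeps the estimator defined and measurable.
  · exact ⟨fun _ => β₀, measurable_const, fun h => absurd h hR⟩

end Consistency

/-! ### Comparison of rates. -/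

section Rates

/-- A radius `R n` which is small compared with the given scales, and large compared with `e n`. -/
lemma exists_radius {ι : Type*} [Finite ι] {e : ℕ → ℝ} {f : ι → ℕ → ℝ}
    (hf : ∀ i, ∀ K : ℝ, ∀ᶠ n in atTop, K * e n < f i n) :
    ∃ R : ℕ → ℝ, (∀ i n, R n ≤ f i n) ∧ (Nonempty ι → ∀ K : ℝ, ∀ᶠ n in atTop, K * e n < R n) := by
  cases nonempty_fintype ι
  by_cases h : Nonempty ι
  · refine ⟨fun n => Finset.univ.inf' Finset.univ_nonempty fun i => f i n,
      fun i n => Finset.inf'_le _ (Finset.mem_univ i), fun _ K => ?_⟩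
    filter_upwards [eventually_all.2 fun i => hf i K] with n hn
    rw [Finset.lt_inf'_iff]
    exact fun i _ => hn i
  · exact ⟨0, fun i => (h ⟨i⟩).elim, fun h' => absurd h' h⟩

lemma eventually_const_mul_lt {e : ℕ → ℝ} (he : Tendsto e atTop (𝓝 0)) {c : ℝ} (hc : 0 < c) (K : ℝ) :
    ∀ᶠ n in atTop, K * e n < c := by
  have := he.const_mul K
  rw [mul_zero] at this
  exact this.eventually_lt_const hc

/-- The rate `√(p/v)` vanishes, even after multiplication by `√p`, if `p³/v → 0`. -/
lemma tendsto_sqrt_mul_sqrt_div {p : ℕ → ℕ} {v : ℕ → ℝ} (hv : ∀ᶠ n in atTop, 0 < v n)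
    (hp : ∀ᶠ n in atTop, 1 ≤ p n) (h : Tendsto (fun n => (p n : ℝ) ^ 3 / v n) atTop (𝓝 0)) :
    Tendsto (fun n => √(p n) * √(p n / v n)) atTop (𝓝 0) := by
  have h1 : Tendsto (fun n => √((p n : ℝ) ^ 3 / v n)) atTop (𝓝 0) := by
    simpa using h.sqrt
  refine squeeze_zero' (Eventually.of_forall fun n => by positivity) ?_ h1
  filter_upwards [hv, hp] with n hn hpn
  have hp' : (1 : ℝ) ≤ p n := by exact_mod_cast hpn
  rw [← Real.sqrt_mul (by positivity)]
  refine Real.sqrt_le_sqrt ?_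
  rw [← mul_div_assoc]
  gcongr
  rw [pow_succ, sq]
  exact le_mul_of_one_le_right (by positivity) hp'

lemma tendsto_measure_zero_of_forall {Ω : Type*} [MeasurableSpace Ω] {μ : Measure Ω}
    {A : ℕ → Set Ω} (h : ∀ ε : ℝ, 0 < ε → ∀ᶠ n in atTop, μ (A n) ≤ ENNReal.ofReal ε) :
    Tendsto (fun n => μ (A n)) atTop (𝓝 0) := by
  rw [ENNReal.tendsto_nhds_zero]
  intro ε hε
  obtain ⟨r, hr0, hr⟩ := ENNReal.lt_iff_exists_real_btwn.1 hε
  filter_upwards [h r (ENNReal.ofReal_pos.1 hr.1)] with n hn using hn.trans hr.2.le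

end Rates

/-! ### The consistency theorem. -/

theorem theorem1 {Ω : Type*} [MeasurableSpace Ω] (μ : Measure Ω) [IsProbabilityMeasure μ]
    {d : ℕ} (hd : 0 < d) (X : PointProcess Ω d)
    -- number of nonzero coefficients, their values, and the diverging dimension
    {s : ℕ} (b : Fin s → ℝ) (hb : ∀ j, b j ≠ 0) (p : ℕ → ℕ) (hsp : ∀ n, s ≤ p n)
    -- the windows `D_n = nE`
    (E : Set (Space d)) (hEconv : Convex ℝ E) (hEcomp : IsCompact E) (hE0 : 0 ∈ interior E)
    -- covariates and weight function
    (z : ℕ → Space d → ℝ) (hz : ∀ j, Measurable (z j))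
    (hzbdd : ∃ M : ℝ, ∀ n, ∀ i < p n, ∀ u, |z i u| ≤ M)
    (w : Space d → ℝ) (hw : Measurable w) (hw0 : ∀ u, 0 ≤ w u) (hwbdd : ∃ M : ℝ, ∀ u, w u ≤ M)
    -- log-linear intensity with true parameter `β₀` in the parameter sets `Θ_n`
    (hρ : ∀ n, X.HasIntensity μ fun u => intensity z u (trueParam b (p n)))
    (Θ : ∀ n, Set (EuclideanSpace ℝ (Fin (p n))))
    (hΘ : ∀ n, IsOpen (Θ n) ∧ Convex ℝ (Θ n) ∧ Bornology.IsBounded (Θ n) ∧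
      trueParam b (p n) ∈ Θ n)
    (hΞ : ∃ Ξ : ∀ n, Set (EuclideanSpace ℝ (Fin (p n))),
      (∀ n, Ξ n ∈ 𝓝 (trueParam b (p n))) ∧
      ∃ M : ℝ, ∀ n, ∀ β ∈ Ξ n, ∀ u : Space d, intensity z u β ≤ M)
    -- bounded product densities of orders `2, …, 2 + t`
    (t : ℕ) (ht : 1 ≤ t)
    (hprod : ∀ k : ℕ, 2 ≤ k → k ≤ 2 + t → ∃ ρk : (Fin k → Space d) → ℝ,
      X.HasProductDensity μ k ρk ∧ ∃ M : ℝ, ∀ v, ρk v ≤ M)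
    -- strong mixing
    (hmix : ∃ τ : ℝ, (d : ℝ) * (2 + t) / t < τ ∧
      (fun q : ℝ => X.mixingCoeff μ 2 ⊤ q) =O[atTop] fun q : ℝ => q ^ (-τ))
    -- `liminf ν_min(|D_n|⁻¹ A_n(w; β₀)) > 0`
    (hA : (0 : EReal) < liminf (fun n => ((minEigenvalue
      ((windowVol E n)⁻¹ • sensitivity z w (window E n) (trueParam b (p n))) : ℝ) : EReal)) atTop)
    -- penalties and tuning parameters
    (pen : ℝ → ℝ → ℝ) (hpen : IsPenaltyFamily pen)
    (lam : ℕ → ℕ → ℝ) (hlam : ∀ n j, 0 ≤ lam n j)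
    (hsmooth : ∃ r : ℕ → Fin s → ℝ,
      (∀ j, Tendsto (fun n => r n j * √(windowVol E n / p n)) atTop atTop) ∧
      ∃ M : ℝ, ∀ᶠ n in atTop, ∀ j : Fin s,
        ContDiffOn ℝ 3 (pen (lam n j)) (Metric.ball |b j| (r n j)) ∧
        ∀ θ ∈ Metric.ball |b j| (r n j), |iteratedDeriv 3 (pen (lam n j)) θ| ≤ M)
    -- growth of the dimension, and the rates of `a_n` and `c_n`
    (hp : Tendsto (fun n => (p n : ℝ) ^ 3 / windowVol E n) atTop (𝓝 0))
    (ha : aSeq pen lam b =O[atTop] fun n => (√(windowVol E n))⁻¹)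
    (hc : cSeq pen lam b =o[atTop] fun _ => (1 : ℝ)) :
    ∃ βhat : ∀ n, Ω → EuclideanSpace ℝ (Fin (p n)),
      (∀ n, Measurable (βhat n)) ∧
      -- with probability tending to one, `βhat n` is a local maximizer of `Q_n(w; ·)`
      Tendsto (fun n => μ {ω | ¬ IsLocalMax
        (fun β : EuclideanSpace ℝ (Fin (p n)) =>
          penLogLik z w pen (lam n) (window E n) (X.pts ω) β) (βhat n ω)}) atTop (𝓝 0) ∧
      IsBigOP μ (fun n ω => ‖βhat n ω - trueParam b (p n)‖)
        (fun n => √(p n) * ((√(windowVol E n))⁻¹ + aSeq pen lam b n)) ∧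
      -- root-`(|D_n| / p_n)` consistency
      IsBigOP μ (fun n ω => ‖βhat n ω - trueParam b (p n)‖) (fun n => √(p n / windowVol E n)) ∧
      -- the local maximizer lies in `Θ_n` as soon as `Θ_n` does not shrink to `β₀` too fast
      ((∀ K : ℝ, ∀ᶠ n in atTop,
          Metric.closedBall (trueParam b (p n)) (K * √(p n / windowVol E n)) ⊆ Θ n) →
        Tendsto (fun n => μ {ω | βhat n ω ∉ Θ n}) atTop (𝓝 0)) := by
  set v := windowVol E with hvdef
  set e : ℕ → ℝ := fun n => √(p n / v n) with hedef
  set β₀ : ∀ n, EuclideanSpace ℝ (Fin (p n)) := fun n => trueParam b (p n) with hβ₀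
  obtain ⟨M, hM⟩ := hzbdd
  obtain ⟨W, hW⟩ := hwbdd
  obtain ⟨ρr, hρr, M₂, hM₂⟩ := hprod (2 + t) (by omega) le_rfl
  obtain ⟨r, hr, M₃, hr3⟩ := hsmooth
  obtain ⟨C, hC0, hC⟩ := exists_measure_lt_norm_score_le (M := M) X μ hEcomp hE0 hz hw hw0 hW ht
    hρr hM₂ hmix
  -- the smallest eigenvalue
  obtain ⟨ν, hν0, hνA⟩ : ∃ ν : ℝ, 0 < ν ∧ ∀ᶠ n in atTop, ν < minEigenvalue
      ((v n)⁻¹ • sensitivity z w (window E n) (β₀ n)) := by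
    obtain ⟨ν, h1, h2⟩ := EReal.lt_iff_exists_real_btwn.1 hA
    refine ⟨ν, by exact_mod_cast h1, ?_⟩
    filter_upwards [eventually_lt_of_lt_liminf h2] with n hn
    exact_mod_cast hn
  -- For `p n = 0` the spectrum is empty and `sInf ∅ = 0`, contradicting `ν > 0`.
  have hp1 : ∀ᶠ n in atTop, 1 ≤ p n := by
    filter_upwards [hνA] with n hn
    by_contra hp0
    have : IsEmpty (Fin (p n)) := by
      rw [Nat.lt_one_iff.1 (not_le.1 hp0)]; infer_instance
    rw [minEigenvalue, spectrum.of_subsingleton, Real.sInf_empty] at hn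
    linarith
  have hvpos : ∀ᶠ n in atTop, 0 < v n :=
    (eventually_ge_atTop 1).mono fun n hn => windowVol_pos hEcomp hE0 hn
  -- rates
  have he0 : ∀ n, 0 ≤ e n := fun n => Real.sqrt_nonneg _
  have hpe := tendsto_sqrt_mul_sqrt_div hvpos hp1 hp
  have he : Tendsto e atTop (𝓝 0) := by
    refine squeeze_zero' (Eventually.of_forall he0) ?_ hpe
    filter_upwards [hp1] with n hn
    have : 1 ≤ √(p n : ℝ) := Real.one_le_sqrt.2 (by exact_mod_cast hn)
    exact le_mul_of_one_le_left (he0 n) this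
  obtain ⟨A, hA0, hAa⟩ := ha.exists_pos
  have haA : ∀ᶠ n in atTop, aSeq pen lam b n ≤ A * e n := by
    filter_upwards [hAa.bound, hvpos, hp1] with n hn hvn hpn
    rw [Real.norm_eq_abs, Real.norm_eq_abs, abs_of_nonneg (aSeq_nonneg _ _ _ _),
      abs_of_nonneg (inv_nonneg.2 (Real.sqrt_nonneg _)), ← Real.sqrt_inv] at hn
    refine hn.trans (mul_le_mul_of_nonneg_left (Real.sqrt_le_sqrt ?_) hA0.le)
    rw [inv_eq_one_div]
    gcongr
    exact_mod_cast hpn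
  -- Half of the allowance `ν / 8`; the other half is left for the third-derivative term.
  have hcν : ∀ᶠ n in atTop, cSeq pen lam b n ≤ ν / 16 := by
    filter_upwards [hc.bound (show 0 < ν / 16 by positivity)] with n hn
    rw [Real.norm_eq_abs, abs_of_nonneg (cSeq_nonneg _ _ _ _)] at hn
    simpa using hn
  -- the radius of the balls
  obtain ⟨R, hRle, hRe⟩ := exists_radius (ι := Option (Option (Fin s))) (e := e)
    -- The scales keep, in this order, the third-derivative term below `ν / 16`, the exponent in
    -- `[-1, 1]`, and `δ` inside the smoothness balls (`r / 2` gives strictness). The index type is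
    -- nonempty even when `s = 0`.
    (f := fun o n => o.elim (ν / (16 * (|M₃| + 1)))
      fun o => o.elim (1 / ((|M| + 1) * √(p n))) fun j => r n j / 2) (by
    rintro (_ | _ | j) K
    · exact eventually_const_mul_lt he (show 0 < ν / (16 * (|M₃| + 1)) by positivity) K
    · filter_upwards [eventually_const_mul_lt hpe one_pos (K * (|M| + 1)), hp1] with n hn hpn
      have : 0 < √(p n : ℝ) := Real.sqrt_pos.2 (by exact_mod_cast hpn)
      simp only [Option.elim]
      rw [lt_div_iff₀ (by positivity)]
      calc _ = K * (|M| + 1) * (√(p n) * e n) := by ring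
        _ < 1 := hn
    · filter_upwards [(hr j).eventually_gt_atTop (2 * K), hvpos, hp1] with n hn hvn hpn
      have hpn' : (0 : ℝ) < p n := by exact_mod_cast hpn
      have h1 : 0 < e n := Real.sqrt_pos.2 (div_pos hpn' hvn)
      have h2 : √(v n / p n) * e n = 1 := by
        rw [← Real.sqrt_mul (by positivity), div_mul_div_cancel₀ hpn'.ne', div_self hvn.ne',
          Real.sqrt_one]
      simp only [Option.elim]
      have h3 := mul_lt_mul_of_pos_right hn h1
      rw [mul_assoc (r n j), h2] at h3
      linarith)
  replace hRe := hRe inferInstance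
  choose βhat hβm hβmax using fun n => exists_measurable_isMaxOn_penLogLik X (p := p n)
    (D := window E n) (lam := lam n) hz (hM n) hw hw0 hW (isCompact_window hEcomp n) hpen (hlam n)
    (β₀ n) (R n)
  -- on the event that the score is of its typical order
  have good : ∀ L : ℝ, 0 < L → ∀ᶠ n in atTop, ∀ ω,
      ‖covariateSum X z w (window E n) (p n) ω - covariateMean z w (window E n) (β₀ n)‖ ≤
        L * √(p n * v n) →
      ‖βhat n ω - β₀ n‖ ≤ 8 / ν * (L + s * A) * e n ∧
        IsLocalMax (fun β => penLogLik z w pen (lam n) (window E n) (X.pts ω) β) (βhat n ω) := by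
    intro L hL
    filter_upwards [hvpos, hp1, hνA, haA, hcν, hr3, hRe 0, hRe (8 / ν * (L + s * A))] with
      n hvn hpn hνn han hcn hrn hR0 hRK ω hω
    rw [zero_mul] at hR0
    obtain ⟨hmem, hmax⟩ := hβmax n hR0.le ω
    rw [mem_closedBall_iff_norm] at hmem
    have hdist : ‖βhat n ω - β₀ n‖ ≤ 8 / ν * (L + s * A) * e n := by
      have h1 : ∀ j, R n ≤ r n j / 2 := fun j => hRle (some (some j)) n
      have h2 : R n ≤ 1 / ((|M| + 1) * √(p n)) := hRle (some none) n
      have h3 : R n ≤ ν / (16 * (|M₃| + 1)) := hRle none n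
      have hsp' : 0 < √(p n : ℝ) := Real.sqrt_pos.2 (by exact_mod_cast hpn)
      have key := norm_le_of_penLogLik_le X (ω := ω) (δ := βhat n ω - β₀ n) (M' := |M₃|) hz
        (hM n) hw hw0 hW (isCompact_window hEcomp n) hvn hpen (hlam n) b
        (aSeq_nonneg pen lam b n) (cSeq_nonneg pen lam b n) (abs_nonneg _)
        (fun j => le_ciSup (f := fun j : Fin s => |deriv (pen (lam n j)) (|b j|)|)
          (finite_range _).bddAbove j)
        (fun j => le_ciSup (f := fun j : Fin s => |iteratedDeriv 2 (pen (lam n j)) (|b j|)|)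
          (finite_range _).bddAbove j)
        (fun j => (hrn j).1) (fun j θ hθ => ((hrn j).2 θ hθ).trans (le_abs_self _))
        hνn.le (fun j => by linarith [h1 j]) ?_ ?_ ?_
      · have e1 : √(p n * v n) = v n * e n := by
          rw [hedef, ← Real.sqrt_sq hvn.le, ← Real.sqrt_mul (sq_nonneg _), Real.sqrt_sq hvn.le]
          congr 1
          field_simp
        rw [e1] at hω
        have h4 : v n * (s * aSeq pen lam b n) ≤ v n * (s * (A * e n)) := by gcongr
        have h5 : v n * (ν / 8 * ‖βhat n ω - β₀ n‖) ≤ v n * ((L + s * A) * e n) := by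
          have : ν / 8 * v n * ‖βhat n ω - β₀ n‖ ≤ L * (v n * e n) + v n * (s * (A * e n)) :=
            key.trans (add_le_add hω h4)
          linarith
        have h6 := le_of_mul_le_mul_left h5 hvn
        have h7 := mul_le_mul_of_nonneg_left h6 (show 0 ≤ 8 / ν by positivity)
        calc _ = 8 / ν * (ν / 8 * ‖βhat n ω - β₀ n‖) := by field_simp
          _ ≤ _ := h7
          _ = _ := by ring
      · have h4 := hmem.trans h2
        rw [le_div_iff₀ (by positivity)] at h4
        have := mul_nonneg (norm_nonneg (βhat n ω - β₀ n)) hsp'.le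
        nlinarith
      · have h4 := hmem.trans h3
        rw [le_div_iff₀ (by positivity)] at h4
        nlinarith [norm_nonneg (βhat n ω - β₀ n)]
      · rw [add_sub_cancel]
        exact hmax (Metric.mem_closedBall_self hR0.le)
    -- `R n` exceeds the bound on the distance, so the maximizer lies in the open ball.
    refine ⟨hdist, hmax.isLocalMax (Metric.closedBall_mem_nhds_of_mem ?_)⟩
    rw [mem_ball_iff_norm]
    exact hdist.trans_lt hRK
  have master : ∀ ε : ℝ, 0 < ε → ∃ K : ℝ, 0 < K ∧ ∀ᶠ n in atTop,
      μ {ω | ¬ (‖βhat n ω - β₀ n‖ ≤ K * e n ∧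
        IsLocalMax (fun β => penLogLik z w pen (lam n) (window E n) (X.pts ω) β) (βhat n ω))} ≤
        ENNReal.ofReal ε := by
    intro ε hε
    -- Then `1 ≤ L` and `C ≤ ε * L ≤ ε * L ^ 2`.
    set L := C / ε + 1 with hLdef
    have hL1 : 1 ≤ L := by rw [hLdef]; linarith [div_nonneg hC0 hε.le]
    have hL : 0 < L := one_pos.trans_le hL1
    have hLε : C / L ^ 2 ≤ ε := by
      rw [div_le_iff₀ (by positivity)]
      have h1 : C ≤ ε * L := by rw [hLdef, mul_add, mul_div_cancel₀ _ hε.ne']; linarith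
      have h2 : ε * L ≤ ε * L ^ 2 := by gcongr; exact le_self_pow₀ hL1 two_ne_zero
      linarith
    refine ⟨8 / ν * (L + s * A), by positivity, ?_⟩
    filter_upwards [good L hL, hp1, eventually_ge_atTop 1] with n hn hpn hn1
    -- Only an inclusion of events is used, so the event of being a local maximizer need not be
    -- measurable.
    refine (measure_mono fun ω hω => ?_).trans ((hC n (p n) (β₀ n) hn1 hpn (hM n) (hρ n) L hL).trans
      (ENNReal.ofReal_le_ofReal hLε))
    by_contra hcon
    exact hω (hn ω (not_lt.1 hcon))
  -- Both rates in the conclusion dominate `e n`, the first because `a_n ≥ 0`, so one bound serves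
  -- both.
  have hOP : ∀ x : ℕ → ℝ, (∀ᶠ n in atTop, e n ≤ |x n|) →
      IsBigOP μ (fun n ω => ‖βhat n ω - β₀ n‖) x := by
    intro x hx ε hε
    obtain ⟨K, hK, h⟩ := master ε hε
    refine ⟨K, hK, ?_⟩
    filter_upwards [h, hx] with n hn hxn
    refine (measure_mono fun ω hω hcon => ?_).trans hn
    have h1 : K * |x n| < |‖βhat n ω - β₀ n‖| := hω
    rw [abs_of_nonneg (norm_nonneg _)] at h1
    have h2 : K * e n ≤ K * |x n| := by gcongr
    linarith [hcon.1]
  refine ⟨βhat, hβm, ?_, hOP _ ?_, hOP _ ?_, fun hΘK => ?_⟩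
  · refine tendsto_measure_zero_of_forall fun ε hε => ?_
    obtain ⟨K, hK, h⟩ := master ε hε
    filter_upwards [h] with n hn
    refine le_trans (measure_mono ?_) hn
    exact fun ω hω hcon => hω hcon.2
  · filter_upwards [hvpos] with n hvn
    refine le_trans ?_ (le_abs_self _)
    have h1 : e n = √(p n) * (√(v n))⁻¹ := by
      rw [hedef, ← div_eq_mul_inv, ← Real.sqrt_div (by positivity)]
    rw [h1]
    have := aSeq_nonneg pen lam b n
    gcongr
    linarith
  · exact Eventually.of_forall fun n => le_abs_self _
  · refine tendsto_measure_zero_of_forall fun ε hε => ?_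
    obtain ⟨K, hK, h⟩ := master ε hε
    filter_upwards [h, hΘK K] with n hn hKn
    refine le_trans (measure_mono ?_) hn
    refine fun ω hω hcon => hω (hKn ?_)
    rw [mem_closedBall_iff_norm]
    exact hcon.1
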